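/- **Theorem (Adequacy).** *Language.* Fix a countably infinite, totally ordered set of qubit variables. Statements are generated by $$S ::= \mathbf{skip}\mid \mathbf{new\ qbit}\ q\mid \mathbf{discard}\ q\mid q\mathrel{*}=U\mid S_0;S_1\mid \mathbf{meas}\ q\,(0\to S_0,1\to S_1)\mid \mathbf{while}\ q\ \mathbf{do}\ S\mid \mathbf{qcase}\ q\,(0\to S_0,1\to S_1),$$ with $U$ any one-qubit unitary, and $\mathrm{Var}(S)$ is the set of variables appearing in $S$. Environments $\Gamma,\Delta$ are finite sets of variables; $q,\Gamma$ denotes $\{q\}\cup\Gamma$ and presupposes $q\notin\Gamma$. A program $(\Gamma;S;\Delta)$ is well-formed if $\Gamma\vdash S\triangleright\Delta$ is derivable from the rules: $\Gamma\vdash\mathbf{skip}\triangleright\Gamma$; $\Gamma\vdash\mathbf{new\ qbit}\ q\triangleright q,\Gamma$; $q,\Gamma\vdash\mathbf{discard}\ q\triangleright\Gamma$; $q,\Gamma\vdash q\mathrel{*}=U\triangleright q,\Gamma$; if $\Gamma\vdash S_0\triangleright\Gamma'$ and $\Gamma'\vdash S_1\triangleright\Gamma''$ then $\Gamma\vdash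 S_0;S_1\triangleright\Gamma''$; if $q,\Gamma\vdash S_k\triangleright\Gamma'$ for $k=0,1$ then $q,\Gamma\vdash\mathbf{meas}\ q\,(0\to S_0,1\to S_1)\triangleright\Gamma'$; if $q,\Gamma\vdash S\triangleright q,\Gamma$ then $q,\Gamma\vdash\mathbf{while}\ q\ \mathbf{do}\ S\triangleright q,\Gamma$; if $\Gamma\vdash S_k\triangleright\Gamma'$ for $k=0,1$ and $q\notin\mathrm{Var}(S_0)\cup\mathrm{Var}(S_1)$ then $q,\Gamma\vdash\mathbf{qcase}\ q\,(0\to S_0,1\to S_1)\triangleright q,\Gamma'$. The output environment is determined by $\Gamma$ and $S$, and is denoted $\Gamma^S$. *States.* $\mathcal H_\Gamma=\mathbb C^{2^{|\Gamma|}}$ has one qubit for each variable of $\Gamma$. $St(\mathcal H_\Gamma)$ is the set of its vectors of norm at most $1$. One-qubit operators with subscript $q$ act on the qubit $q$, and tensor products with the identity are omitted. *Operational semantics.* Transitions $[S,|\psi\rangle]_\Gamma\to(|\psi'\rangle,\nu)$, with $\nu\in\{0,1\}$, are derived by the following rules. - $[\mathbf{skip},|\psi\rangle]\to(|\psi\rangle,1)$;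 $[\mathbf{new\ qbit}\ q,|\psi\rangle]\to(|0\rangle_q\otimes|\psi\rangle,1)$; $[q\mathrel{*}=U,|\psi\rangle]\to(U_q|\psi\rangle,1)$. - $[\mathbf{discard}\ q,|\psi\rangle]\to(\langle0|_q|\psi\rangle,1)$ and $[\mathbf{discard}\ q,|\psi\rangle]\to(\langle1|_q|\psi\rangle,0)$. - If $[S_0,|\psi\rangle]\to(|\psi'\rangle,\nu)$ and $[S_1,|\psi'\rangle]\to(|\psi''\rangle,\mu)$, then $[S_0;S_1,|\psi\rangle]\to(|\psi''\rangle,\nu\mu)$. - If $[S_0,|0\rangle\langle0|_q|\psi\rangle]\to(|\psi'\rangle,\nu)$, then $[\mathbf{meas}\ q\,(0\to S_0,1\to S_1),|\psi\rangle]\to(|\psi'\rangle,\nu)$. If $[S_1,|1\rangle\langle1|_q|\psi\rangle]\to(|\psi'\rangle,\nu)$, then $[\mathbf{meas}\ q\,(0\to S_0,1\to S_1),|\psi\rangle]\to(|\psi'\rangle,0)$. - $[\mathbf{while}\ q\ \mathbf{do}\ S,|\psi\rangle]\to(|0\rangle\langle0|_q|\psi\rangle,1)$. If $[S;\mathbf{while}\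 q\ \mathbf{do}\ S,|1\rangle\langle1|_q|\psi\rangle]\to(|\psi'\rangle,\nu)$, then $[\mathbf{while}\ q\ \mathbf{do}\ S,|\psi\rangle]\to(|\psi'\rangle,0)$. - If $[S_k,\langle k|_q|\psi\rangle]\to(|\psi_k\rangle,\nu_k)$ for $k=0,1$, then $[\mathbf{qcase}\ q\,(0\to S_0,1\to S_1),|\psi\rangle]\to(\nu_1|0\rangle_q\otimes|\psi_0\rangle+\nu_0|1\rangle_q\otimes|\psi_1\rangle,\ \nu_0\nu_1)$. The output ensemble $\mathscr E([S,|\psi\rangle]_\Gamma)$ is the multiset of the values $v\neq(0,0)$ with $[S,|\psi\rangle]_\Gamma\to v$, the multiplicity of $v$ being the number of distinct derivations of $[S,|\psi\rangle]_\Gamma\to v$. *Denotational semantics.* A quantum operation is a completely positive trace non-increasing linear map $\mathcal L(\mathcal H_A)\to\mathcal L(\mathcal H_B)$. Quantum operations are ordered by $\mathcal C\le\mathcal D$ iff $(\mathcal D\otimes\mathcal I_E)(\rho)-(\mathcal C\otimes\mathcal I_E)(\rho)$ is positive semidefinite for all finite-dimensional $\mathcal H_E$ and all density matrices $\rho$ (positive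 semidefinite, trace at most $1$) on $\mathcal H_A\otimes\mathcal H_E$. Let $\mathrm{Vac}$ be a one-dimensional space. For a linear map $\mathcal C$ from $\mathcal L(\mathcal H_A)$ to $\mathcal L(\mathcal H_B)$ and $F\in\mathcal L(\mathcal H_A,\mathcal H_B)$, let $$\tilde{\mathcal C}^F\begin{bmatrix}R&u\\v&w\end{bmatrix}=\begin{bmatrix}\mathcal C(R)&Fu\\vF^\dagger&w\end{bmatrix}$$ for operators on $\mathcal H_A\oplus\mathrm{Vac}$. Let $\mathcal K_{\Gamma;\Delta}$ be the set of pairs $(\mathcal C,F)$, with $\mathcal C:\mathcal L(\mathcal H_\Gamma)\to\mathcal L(\mathcal H_\Delta)$ and $F\in\mathcal L(\mathcal H_\Gamma,\mathcal H_\Delta)$, such that $\mathcal C$ and $\tilde{\mathcal C}^F$ are quantum operations, ordered by $(\mathcal C,F)\le(\mathcal D,G)$ iff $\tilde{\mathcal C}^F\le\tilde{\mathcal D}^G$. Put $\mathcal P^q_k=|k\rangle\langle k|_q(\cdot)|k\rangle\langle k|_q$ and $$(\mathcal D,G)\circ(\mathcal C,F)=(\mathcal D\circ\mathcal C,GF),\qquad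 \overline{\mathbf{meas}}_q[(\mathcal C_0,F_0),(\mathcal C_1,F_1)]=(\mathcal C_0\circ\mathcal P^q_0+\mathcal C_1\circ\mathcal P^q_1,\ F_0|0\rangle\langle0|_q),$$ $$\overline{\mathbf{qcase}}_q[(\mathcal C_0,F_0),(\mathcal C_1,F_1)]=\bigl(\mathcal P^q_0\otimes\mathcal C_0+\mathcal P^q_1\otimes\mathcal C_1+G_0(\cdot)G_1^\dagger+G_1(\cdot)G_0^\dagger,\ G_0+G_1\bigr),\quad G_k=|k\rangle\langle k|_q\otimes F_k.$$ The interpretation of well-formed programs is defined by $$[\![\mathbf{skip}]\!]_\Gamma=(\mathcal I_\Gamma,I_\Gamma),\quad [\![\mathbf{new\ qbit}\ q]\!]_\Gamma=(|0\rangle\langle0|_q\otimes\mathcal I_\Gamma,\ |0\rangle_q\otimes I_\Gamma),\quad [\![\mathbf{discard}\ q]\!]_{q,\Gamma}=(\mathrm{Tr}_q,\ \langle0|_q\otimes I_\Gamma),$$ $$[\![q\mathrel{*}=U]\!]_{q,\Gamma}=(U_q(\cdot)U_q^\dagger,\ U_q),\quad [\![S_0;S_1]\!]_\Gamma=[\![S_1]\!]_{\Gamma^{S_0}}\circ[\![S_0]\!]_\Gamma,\quad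 [\![\mathbf{meas}\ q\,(0\to S_0,1\to S_1)]\!]_{q,\Gamma}=\overline{\mathbf{meas}}_q\bigl[[\![S_0]\!]_{q,\Gamma},[\![S_1]\!]_{q,\Gamma}\bigr],$$ $$[\![\mathbf{qcase}\ q\,(0\to S_0,1\to S_1)]\!]_{q,\Gamma}=\overline{\mathbf{qcase}}_q\bigl[[\![S_0]\!]_\Gamma,[\![S_1]\!]_\Gamma\bigr],$$ and $[\![\mathbf{while}\ q\ \mathbf{do}\ S]\!]_{q,\Gamma}$ is the least fixed point in $\mathcal K_{q,\Gamma;q,\Gamma}$ of $(\mathcal C,F)\mapsto\overline{\mathbf{meas}}_q\bigl[(\mathcal I_{q,\Gamma},I_{q,\Gamma}),(\mathcal C,F)\circ[\![S]\!]_{q,\Gamma}\bigr]$. *Statement.* Let $(\Gamma;S;\Delta)$ be a well-formed program, $|\psi\rangle\in St(\mathcal H_\Gamma)$ and $[\![S]\!]_\Gamma=(\mathcal C,F)$. Then all multiplicities in $\mathscr E([S,|\psi\rangle]_\Gamma)$ are finite, and for every indexed family $\{(|\psi'_i\rangle,\nu_i)\}_i$ listing $\mathscr E([S,|\psi\rangle]_\Gamma)$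 with multiplicity, $$\mathcal C(|\psi\rangle\langle\psi|)=\sum_i|\psi'_i\rangle\langle\psi'_i|\qquad\text{and}\qquad F|\psi\rangle=\sum_i\nu_i|\psi'_i\rangle ,$$ where both families are (unconditionally) summable. -/

import Mathlib

open scoped Matrix BigOperators ComplexOrder

universe u

namespace QLang

/-! ### Syntax and well-formedness -/

/-- Statements over a set `X` of qubit variables; `U` ranges over all one-qubit unitary gates. -/
inductive Stmt (X : Type u) : Type u
  | skip : Stmt X
  | newQbit (q : X) : Stmt X
  | discard (q : X) : Stmt X
  | gate (q : X) (U : Matrix.unitaryGroup (Fin 2) ℂ) : Stmt X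
  | seq (S₀ S₁ : Stmt X) : Stmt X
  | meas (q : X) (S₀ S₁ : Stmt X) : Stmt X
  | whileDo (q : X) (S : Stmt X) : Stmt X
  | qcase (q : X) (S₀ S₁ : Stmt X) : Stmt X

/-- The variables appearing in a statement. -/
def Stmt.vars {X : Type u} : Stmt X → Set X
  | .skip => ∅
  | .newQbit q => {q}
  | .discard q => {q}
  | .gate q _ => {q}
  | .seq S₀ S₁ => S₀.vars ∪ S₁.vars
  | .meas q S₀ S₁ => {q} ∪ S₀.vars ∪ S₁.vars
  | .whileDo q S => {q} ∪ S.vars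
  | .qcase q S₀ S₁ => {q} ∪ S₀.vars ∪ S₁.vars

variable {X : Type u} [DecidableEq X]

/-- `Ext q Γ Γ₁` says that `Γ₁` is the environment `q, Γ`, which presupposes `q ∉ Γ`. -/
structure Ext (q : X) (Γ Γ₁ : Finset X) : Prop where
  notMem : q ∉ Γ
  eq_insert : Γ₁ = insert q Γ

theorem Ext.mem {q : X} {Γ Γ₁ : Finset X} (h : Ext q Γ Γ₁) : q ∈ Γ₁ := by
  rw [h.eq_insert]; exact Finset.mem_insert_self q Γ

theorem Ext.subset {q : X} {Γ Γ₁ : Finset X} (h : Ext q Γ Γ₁) : Γ ⊆ Γ₁ := by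
  rw [h.eq_insert]; exact Finset.subset_insert q Γ

/-- Derivations of the judgment `Γ ⊢ S ▷ Δ`. The program `(Γ; S; Δ)` is well-formed when this type
is inhabited; it never has more than one element (`Typing.subsingleton`), so that defining a
semantics by recursion on it amounts to defining it on well-formed programs. -/
inductive Typing : Finset X → Stmt X → Finset X → Type u
  | skip {Γ : Finset X} : Typing Γ .skip Γ
  | newQbit {Γ Δ : Finset X} {q : X} (h : Ext q Γ Δ) : Typing Γ (.newQbit q) Δ
  | discard {Γ Δ : Finset X} {q : X} (h : Ext q Δ Γ) : Typing Γ (.discard q) Δ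
  | gate {Γ : Finset X} {q : X} {U : Matrix.unitaryGroup (Fin 2) ℂ} (h : q ∈ Γ) :
      Typing Γ (.gate q U) Γ
  | seq {Γ Γ' Γ'' : Finset X} {S₀ S₁ : Stmt X}
      (t₀ : Typing Γ S₀ Γ') (t₁ : Typing Γ' S₁ Γ'') : Typing Γ (.seq S₀ S₁) Γ''
  | meas {Γ Γ' : Finset X} {q : X} {S₀ S₁ : Stmt X} (h : q ∈ Γ)
      (t₀ : Typing Γ S₀ Γ') (t₁ : Typing Γ S₁ Γ') : Typing Γ (.meas q S₀ S₁) Γ'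
  | whileDo {Γ : Finset X} {q : X} {S : Stmt X} (h : q ∈ Γ)
      (t : Typing Γ S Γ) : Typing Γ (.whileDo q S) Γ
  | qcase {Γ Γ₁ Δ Δ₁ : Finset X} {q : X} {S₀ S₁ : Stmt X} (hΓ : Ext q Γ Γ₁) (hΔ : Ext q Δ Δ₁)
      (t₀ : Typing Γ S₀ Δ) (t₁ : Typing Γ S₁ Δ) (hq : q ∉ S₀.vars ∪ S₁.vars) :
      Typing Γ₁ (.qcase q S₀ S₁) Δ₁

theorem Ext.unique_left {q : X} {Γ Γ' Γ₁ : Finset X} (h : Ext q Γ Γ₁) (h' : Ext q Γ' Γ₁) :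
    Γ = Γ' := by
  rw [← Finset.erase_insert h.notMem, ← Finset.erase_insert h'.notMem, ← h.eq_insert,
    ← h'.eq_insert]

theorem Typing.output_unique {Γ Δ Δ' : Finset X} {S : Stmt X} (t : Typing Γ S Δ)
    (t' : Typing Γ S Δ') : Δ = Δ' := by
  induction t generalizing Δ' with
  | skip => cases t'; rfl
  | newQbit h => cases t' with | newQbit h' => rw [h.eq_insert, h'.eq_insert]
  | discard h => cases t' with | discard h' => exact h.unique_left h'
  | gate h => cases t'; rfl
  | seq t₀ t₁ ih₀ ih₁ =>
    cases t' with
    | seq s₀ s₁ => obtain rfl := ih₀ s₀; exact ih₁ s₁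
  | meas h t₀ t₁ ih₀ ih₁ => cases t' with | meas h' s₀ s₁ => exact ih₀ s₀
  | whileDo h t ih => cases t'; rfl
  | qcase hΓ hΔ t₀ t₁ hq ih₀ ih₁ =>
    cases t' with
    | qcase hΓ' hΔ' s₀ s₁ hq' =>
      obtain rfl := hΓ.unique_left hΓ'
      obtain rfl := ih₀ s₀
      rw [hΔ.eq_insert, hΔ'.eq_insert]

theorem Typing.subsingleton {Γ Δ : Finset X} {S : Stmt X} (t t' : Typing Γ S Δ) : t = t' := by
  induction t with
  | skip => cases t'; rfl
  | newQbit h => cases t'; rfl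
  | discard h => cases t'; rfl
  | gate h => cases t'; rfl
  | seq t₀ t₁ ih₀ ih₁ =>
    cases t' with
    | seq s₀ s₁ =>
      obtain rfl := t₀.output_unique s₀
      rw [ih₀ s₀, ih₁ s₁]
  | meas h t₀ t₁ ih₀ ih₁ => cases t' with | meas h' s₀ s₁ => rw [ih₀ s₀, ih₁ s₁]
  | whileDo h t ih => cases t' with | whileDo h' s => rw [ih s]
  | qcase hΓ hΔ t₀ t₁ hq ih₀ ih₁ =>
    cases t' with
    | qcase hΓ' hΔ' s₀ s₁ hq' =>
      obtain rfl := hΓ.unique_left hΓ'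
      obtain rfl := hΔ.unique_left hΔ'
      rw [ih₀ s₀, ih₁ s₁]

/-! ### State spaces and one-qubit operators -/

/-- Computational basis states of the qubits of `Γ`: a bit for each variable of `Γ`. -/
abbrev Basis (Γ : Finset X) : Type u := {p : X // p ∈ Γ} → Fin 2

/-- The state space of the qubits of `Γ`, of dimension `2 ^ |Γ|`, in its computational basis. As the
basis is labelled by variable names, no order of the tensor factors has to be chosen. -/
abbrev Hilb (Γ : Finset X) : Type u := Basis Γ → ℂ

/-- Linear maps from the state space of `Γ` to that of `Δ`. -/
abbrev Op (Γ Δ : Finset X) : Type u := Matrix (Basis Δ) (Basis Γ) ℂ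

/-- The (subnormalized) states: vectors of Euclidean norm at most one. -/
def St (Γ : Finset X) : Set (Hilb Γ) := {ψ | ∑ x, ‖ψ x‖ ^ 2 ≤ 1}

/-- The operator `|ψ⟩⟨ψ|`. -/
def ketbra {A : Type*} (ψ : A → ℂ) : Matrix A A ℂ := Matrix.vecMulVec ψ (star ψ)

/-- The operator `|b⟩_q ⊗ I_Γ`, from the space of `Γ` to that of `q, Γ`. -/
def ket {q : X} {Γ Γ₁ : Finset X} (h : Ext q Γ Γ₁) (b : Fin 2) : Op Γ Γ₁ := fun y x =>
  if y ⟨q, h.mem⟩ = b ∧ ∀ p : {p : X // p ∈ Γ}, y ⟨p.1, h.subset p.2⟩ = x p then 1 else 0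

/-- The operator `⟨b|_q ⊗ I_Γ`, from the space of `q, Γ` to that of `Γ`. -/
def bra {q : X} {Γ Γ₁ : Finset X} (h : Ext q Γ Γ₁) (b : Fin 2) : Op Γ₁ Γ := (ket h b)ᴴ

/-- The projector `|b⟩⟨b|_q`, tensored with the identity on the other qubits of `Γ`. -/
def proj {q : X} {Γ : Finset X} (h : q ∈ Γ) (b : Fin 2) : Op Γ Γ :=
  Matrix.diagonal fun x => if x ⟨q, h⟩ = b then 1 else 0

/-- The gate `U` on the qubit `q`, tensored with the identity on the other qubits of `Γ`. -/
def gateOp {q : X} {Γ : Finset X} (h : q ∈ Γ) (U : Matrix (Fin 2) (Fin 2) ℂ) : Op Γ Γ :=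
  fun y x => if ∀ p : {p : X // p ∈ Γ}, p.1 ≠ q → y p = x p then U (y ⟨q, h⟩) (x ⟨q, h⟩) else 0

/-! ### Operational semantics -/

/-- The bit `ν` as a complex number, `0` or `1`. -/
def bit (ν : Bool) : ℂ := if ν then 1 else 0

/-- Derivations of the big-step transition `[S, ψ]_Γ → (φ, ν)`, for a well-formed program
`(Γ; S; Δ)`. It is valued in `Type` because derivations are counted below. -/
inductive Exec : {Γ Δ : Finset X} → {S : Stmt X} → Typing Γ S Δ → Hilb Γ → Hilb Δ → Bool → Type u
  | skip {Γ : Finset X} (ψ : Hilb Γ) : Exec Typing.skip ψ ψ true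
  | newQbit {Γ Δ : Finset X} {q : X} (h : Ext q Γ Δ) (ψ : Hilb Γ) :
      Exec (Typing.newQbit h) ψ (ket h 0 *ᵥ ψ) true
  | discard₀ {Γ Δ : Finset X} {q : X} (h : Ext q Δ Γ) (ψ : Hilb Γ) :
      Exec (Typing.discard h) ψ (bra h 0 *ᵥ ψ) true
  | discard₁ {Γ Δ : Finset X} {q : X} (h : Ext q Δ Γ) (ψ : Hilb Γ) :
      Exec (Typing.discard h) ψ (bra h 1 *ᵥ ψ) false
  | gate {Γ : Finset X} {q : X} {U : Matrix.unitaryGroup (Fin 2) ℂ} (h : q ∈ Γ) (ψ : Hilb Γ) :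
      Exec (Typing.gate (U := U) h) ψ (gateOp h U.1 *ᵥ ψ) true
  | seq {Γ Γ' Γ'' : Finset X} {S₀ S₁ : Stmt X} {t₀ : Typing Γ S₀ Γ'} {t₁ : Typing Γ' S₁ Γ''}
      {ψ : Hilb Γ} {φ : Hilb Γ'} {χ : Hilb Γ''} {ν μ : Bool}
      (d₀ : Exec t₀ ψ φ ν) (d₁ : Exec t₁ φ χ μ) : Exec (Typing.seq t₀ t₁) ψ χ (ν && μ)
  | meas₀ {Γ Γ' : Finset X} {q : X} {S₀ S₁ : Stmt X} (h : q ∈ Γ) {t₀ : Typing Γ S₀ Γ'}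
      {t₁ : Typing Γ S₁ Γ'} {ψ : Hilb Γ} {φ : Hilb Γ'} {ν : Bool}
      (d : Exec t₀ (proj h 0 *ᵥ ψ) φ ν) : Exec (Typing.meas h t₀ t₁) ψ φ ν
  | meas₁ {Γ Γ' : Finset X} {q : X} {S₀ S₁ : Stmt X} (h : q ∈ Γ) {t₀ : Typing Γ S₀ Γ'}
      {t₁ : Typing Γ S₁ Γ'} {ψ : Hilb Γ} {φ : Hilb Γ'} {ν : Bool}
      (d : Exec t₁ (proj h 1 *ᵥ ψ) φ ν) : Exec (Typing.meas h t₀ t₁) ψ φ false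
  | while₀ {Γ : Finset X} {q : X} {S : Stmt X} (h : q ∈ Γ) {t : Typing Γ S Γ} (ψ : Hilb Γ) :
      Exec (Typing.whileDo h t) ψ (proj h 0 *ᵥ ψ) true
  | while₁ {Γ : Finset X} {q : X} {S : Stmt X} (h : q ∈ Γ) {t : Typing Γ S Γ} {ψ φ : Hilb Γ}
      {ν : Bool} (d : Exec (Typing.seq t (Typing.whileDo h t)) (proj h 1 *ᵥ ψ) φ ν) :
      Exec (Typing.whileDo h t) ψ φ false
  | qcase {Γ Γ₁ Δ Δ₁ : Finset X} {q : X} {S₀ S₁ : Stmt X} (hΓ : Ext q Γ Γ₁) (hΔ : Ext q Δ Δ₁)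
      {t₀ : Typing Γ S₀ Δ} {t₁ : Typing Γ S₁ Δ} (hq : q ∉ S₀.vars ∪ S₁.vars) {ψ : Hilb Γ₁}
      {φ₀ φ₁ : Hilb Δ} {ν₀ ν₁ : Bool}
      (d₀ : Exec t₀ (bra hΓ 0 *ᵥ ψ) φ₀ ν₀) (d₁ : Exec t₁ (bra hΓ 1 *ᵥ ψ) φ₁ ν₁) :
      Exec (Typing.qcase hΓ hΔ t₀ t₁ hq) ψ
        (bit ν₁ • (ket hΔ 0 *ᵥ φ₀) + bit ν₀ • (ket hΔ 1 *ᵥ φ₁)) (ν₀ && ν₁)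

/-- The output ensemble of the configuration `[S, ψ]_Γ`, as the function giving the multiplicity of
each value: the number of derivations of that value, except that the value `(0, 0)` is removed. -/
noncomputable def outputEnsemble {Γ Δ : Finset X} {S : Stmt X} (t : Typing Γ S Δ) (ψ : Hilb Γ)
    (v : Hilb Δ × Bool) : ℕ∞ :=
  open Classical in if v = (0, false) then 0 else ENat.card (Exec t ψ v.1 v.2)

/-- The family `f` lists the elements of the multiset with multiplicities `M`. -/
def Enumerates {ι V : Type*} (f : ι → V) (M : V → ℕ∞) : Prop :=
  ∀ v, ENat.card {i // f i = v} = M v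

/-! ### Quantum operations -/

/-- Linear maps between algebras of operators. -/
abbrev SuperOp (A B : Type*) : Type _ := Matrix A A ℂ →ₗ[ℂ] Matrix B B ℂ

/-- The map `𝒞 ⊗ ℐ_E`, applied blockwise. -/
def ampliation {A B : Type*} (C : SuperOp A B) (E : Type*)
    (ρ : Matrix (A × E) (A × E) ℂ) : Matrix (B × E) (B × E) ℂ :=
  fun y z => C (fun a a' => ρ (a, y.2) (a', z.2)) y.1 z.1

/-- Completely positive trace non-increasing maps. -/
structure IsQuantumOp {A B : Type*} [Fintype A] [Fintype B] (C : SuperOp A B) : Prop where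
  completelyPositive : ∀ (n : ℕ) (ρ : Matrix (A × Fin n) (A × Fin n) ℂ),
    ρ.PosSemidef → (ampliation C (Fin n) ρ).PosSemidef
  trace_le : ∀ ρ : Matrix A A ℂ, ρ.PosSemidef → (C ρ).trace.re ≤ ρ.trace.re

/-- Density matrices: positive semidefinite of trace at most one. -/
def IsDensity {A : Type*} [Fintype A] (ρ : Matrix A A ℂ) : Prop :=
  ρ.PosSemidef ∧ ρ.trace.re ≤ 1

/-- The Löwner order on quantum operations. -/
def LoewnerLE {A B : Type*} [Fintype A] [Fintype B] (C D : SuperOp A B) : Prop :=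
  ∀ (n : ℕ) (ρ : Matrix (A × Fin n) (A × Fin n) ℂ), IsDensity ρ →
    (ampliation D (Fin n) ρ - ampliation C (Fin n) ρ).PosSemidef

/-- The map `ρ ↦ M ρ N`. -/
def sandwich {A B : Type*} [Fintype A] (M : Matrix B A ℂ) (N : Matrix A B ℂ) :
    SuperOp A B where
  toFun ρ := M * ρ * N
  map_add' ρ σ := by rw [Matrix.mul_add, Matrix.add_mul]
  map_smul' c ρ := by simp

/-- The map `ρ ↦ M ρ M†`. -/
def conjBy {A B : Type*} [Fintype A] (M : Matrix B A ℂ) : SuperOp A B := sandwich M Mᴴ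

/-- The extension of `(𝒞, F)` to operators on `ℋ_A ⊕ Vac`, as a block matrix
`[[R, u], [v, w]] ↦ [[𝒞 R, F u], [v F†, w]]`, which is
`𝒞(P ρ P) + F ρ |vac⟩⟨vac| + |vac⟩⟨vac| ρ F† + |vac⟩⟨vac| ρ |vac⟩⟨vac|`. -/
def vacuumExt {A B : Type*} [Fintype A] (C : SuperOp A B) (F : Matrix B A ℂ) :
    SuperOp (A ⊕ Unit) (B ⊕ Unit) where
  toFun ρ := Matrix.fromBlocks (C ρ.toBlocks₁₁) (F * ρ.toBlocks₁₂) (ρ.toBlocks₂₁ * Fᴴ) ρ.toBlocks₂₂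
  map_add' ρ σ := by
    have h₁ : (ρ + σ).toBlocks₁₁ = ρ.toBlocks₁₁ + σ.toBlocks₁₁ := rfl
    have h₂ : (ρ + σ).toBlocks₁₂ = ρ.toBlocks₁₂ + σ.toBlocks₁₂ := rfl
    have h₃ : (ρ + σ).toBlocks₂₁ = ρ.toBlocks₂₁ + σ.toBlocks₂₁ := rfl
    have h₄ : (ρ + σ).toBlocks₂₂ = ρ.toBlocks₂₂ + σ.toBlocks₂₂ := rfl
    rw [h₁, h₂, h₃, h₄, Matrix.fromBlocks_add, map_add, Matrix.mul_add, Matrix.add_mul]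
  map_smul' c ρ := by
    have h₁ : (c • ρ).toBlocks₁₁ = c • ρ.toBlocks₁₁ := rfl
    have h₂ : (c • ρ).toBlocks₁₂ = c • ρ.toBlocks₁₂ := rfl
    have h₃ : (c • ρ).toBlocks₂₁ = c • ρ.toBlocks₂₁ := rfl
    have h₄ : (c • ρ).toBlocks₂₂ = c • ρ.toBlocks₂₂ := rfl
    rw [h₁, h₂, h₃, h₄, RingHom.id_apply, Matrix.fromBlocks_smul, map_smul, Matrix.mul_smul,
      Matrix.smul_mul]

/-! ### Denotational semantics -/

/-- Pairs `(𝒞, F)` of a map on operators and a transformation matrix. -/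
abbrev Den (Γ Δ : Finset X) : Type u := SuperOp (Basis Γ) (Basis Δ) × Op Γ Δ

/-- The pairs `(𝒞, F)` such that `𝒞` and its extension given by `F` are quantum operations. -/
def vacuumPairs (Γ Δ : Finset X) : Set (Den Γ Δ) :=
  {p | IsQuantumOp p.1 ∧ IsQuantumOp (vacuumExt p.1 p.2)}

/-- The order on such pairs: the Löwner order of the vacuum extensions. -/
def Den.LE {Γ Δ : Finset X} (p r : Den Γ Δ) : Prop :=
  LoewnerLE (vacuumExt p.1 p.2) (vacuumExt r.1 r.2)

/-- Composition, `p` after `r`. -/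
def Den.comp {Γ Γ' Γ'' : Finset X} (p : Den Γ' Γ'') (r : Den Γ Γ') : Den Γ Γ'' :=
  (p.1 ∘ₗ r.1, p.2 * r.2)

def Den.id (Γ : Finset X) : Den Γ Γ := (LinearMap.id, 1)

def Den.meas {q : X} {Γ Γ' : Finset X} (h : q ∈ Γ) (p₀ p₁ : Den Γ Γ') : Den Γ Γ' :=
  (p₀.1 ∘ₗ conjBy (proj h 0) + p₁.1 ∘ₗ conjBy (proj h 1), p₀.2 * proj h 0)

/-- Here `ket hΔ b * F * bra hΓ b` is the operator `|b⟩⟨b|_q ⊗ F`, and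
`conjBy (ket hΔ b) ∘ₗ 𝒞 ∘ₗ conjBy (bra hΓ b)` is the map `|b⟩⟨b|_q (·) |b⟩⟨b|_q ⊗ 𝒞`. -/
def Den.qcase {q : X} {Γ Γ₁ Δ Δ₁ : Finset X} (hΓ : Ext q Γ Γ₁) (hΔ : Ext q Δ Δ₁)
    (p₀ p₁ : Den Γ Δ) : Den Γ₁ Δ₁ :=
  (conjBy (ket hΔ 0) ∘ₗ p₀.1 ∘ₗ conjBy (bra hΓ 0)
      + conjBy (ket hΔ 1) ∘ₗ p₁.1 ∘ₗ conjBy (bra hΓ 1)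
      + sandwich (ket hΔ 0 * p₀.2 * bra hΓ 0) (ket hΔ 1 * p₁.2 * bra hΓ 1)ᴴ
      + sandwich (ket hΔ 1 * p₁.2 * bra hΓ 1) (ket hΔ 0 * p₀.2 * bra hΓ 0)ᴴ,
    ket hΔ 0 * p₀.2 * bra hΓ 0 + ket hΔ 1 * p₁.2 * bra hΓ 1)

/-- `p` is a least fixed point of `Φ` among the pairs in `vacuumPairs Γ Γ`. -/
def IsLfp {Γ : Finset X} (Φ : Den Γ Γ → Den Γ Γ) (p : Den Γ Γ) : Prop :=
  p ∈ vacuumPairs Γ Γ ∧ Φ p = p ∧ ∀ r ∈ vacuumPairs Γ Γ, Φ r = r → p.LE r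

/-- The least fixed point of `Φ` (and the pair `(0, 0)` if there is none). -/
noncomputable def lfp {Γ : Finset X} (Φ : Den Γ Γ → Den Γ Γ) : Den Γ Γ :=
  open Classical in if h : ∃ p, IsLfp Φ p then h.choose else 0

/-- The denotation of the well-formed program `(Γ; S; Δ)`. -/
noncomputable def den : {Γ Δ : Finset X} → {S : Stmt X} → Typing Γ S Δ → Den Γ Δ
  | Γ, _, _, .skip => Den.id Γ
  | _, _, _, .newQbit h => (conjBy (ket h 0), ket h 0)
  | _, _, _, .discard h => (conjBy (bra h 0) + conjBy (bra h 1), bra h 0)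
  | _, _, _, .gate (U := U) h => (conjBy (gateOp h U.1), gateOp h U.1)
  | _, _, _, .seq t₀ t₁ => (den t₁).comp (den t₀)
  | _, _, _, .meas h t₀ t₁ => Den.meas h (den t₀) (den t₁)
  | Γ, _, _, .whileDo h t => lfp fun p => Den.meas h (Den.id Γ) (p.comp (den t))
  | _, _, _, .qcase hΓ hΔ t₀ t₁ _ => Den.qcase hΓ hΔ (den t₀) (den t₁)

end QLang

/-! The sums are taken over derivations rather than over values, and the invariant proved by
induction on the typing derivation is `Adequate`: for every vector `ψ`, of any norm, the operators
`|φ⟩⟨φ|` over all derivations sum to `𝒞(|ψ⟩⟨ψ|)`, and exactly one derivation carries `ν = 1`, with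
final vector `F ψ`. The second sum of the theorem therefore has a single term that can be nonzero.

Uniqueness of that derivation also explains `qcase`. The factors `ν₀`, `ν₁` leave in each diagonal
block only the pairs whose other component is the distinguished derivation, and in the interference
terms only the one pair where both are distinguished. These give the terms `G₀(·)G₁†` and
`G₁(·)G₀†`.

For a loop, every fixed point has `F = |0⟩⟨0|_q`, and its first component solves `C = E + C ∘ T`,
with `E` the projection on outcome 0 and `T` the body after projection on outcome 1. The series `∑ₙ
E Tⁿ` converges because its partial traces are bounded, and it lies below every completely positive
solution (`exists_isIteration_loop`). Its `n`-th term is the contribution of the derivations with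
`n` iterations (`hasSum_iterations_eq`). To have these bounds for the body, all denotations are
shown to satisfy `IsVacuumPair`, a condition stable under the constructors which makes `𝒞` and its
vacuum extension quantum operations.

Unconditional summability comes from positivity: traces of positive operators are nonnegative and
dominate their entries (`hasSum_ketbra_sigma`). -/

namespace QLang

/-! ### Completely positive maps -/

section CompletelyPositive

variable {A B D : Type*}

/-- Complete positivity, without any condition on the trace. -/
def IsCP (C : SuperOp A B) : Prop :=
  ∀ (n : ℕ) (ρ : Matrix (A × Fin n) (A × Fin n) ℂ),
    ρ.PosSemidef → (ampliation C (Fin n) ρ).PosSemidef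

theorem IsCP.map_posSemidef {C : SuperOp A B} (hC : IsCP C) {ρ : Matrix A A ℂ}
    (hρ : ρ.PosSemidef) : (C ρ).PosSemidef :=
  (hC 1 _ (hρ.submatrix Prod.fst)).submatrix fun b => (b, 0)

theorem IsCP.zero : IsCP (0 : SuperOp A B) := fun _ _ _ => Matrix.PosSemidef.zero

theorem IsCP.add {C C' : SuperOp A B} (hC : IsCP C) (hC' : IsCP C') : IsCP (C + C') :=
  fun n ρ hρ => (hC n ρ hρ).add (hC' n ρ hρ)

theorem IsCP.comp {C : SuperOp A B} {C' : SuperOp B D} (hC' : IsCP C') (hC : IsCP C) :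
    IsCP (C' ∘ₗ C) :=
  fun n ρ hρ => hC' n _ (hC n ρ hρ)

theorem IsCP.id : IsCP (LinearMap.id : SuperOp A A) := fun _ _ hρ => hρ

theorem IsCP.pow {T : Module.End ℂ (Matrix A A ℂ)} (hT : IsCP T) (n : ℕ) :
    IsCP (T ^ n) := by
  induction n with
  | zero => exact IsCP.id
  | succ n ih => rw [pow_succ]; exact ih.comp hT

theorem isClosed_posSemidef [Fintype A] : IsClosed {M : Matrix A A ℂ | M.PosSemidef} := by
  simp only [Matrix.posSemidef_iff_dotProduct_mulVec, Set.ofPred_and, Set.ofPred_forall]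
  refine IsClosed.inter (isClosed_eq (by fun_prop) continuous_id) (isClosed_iInter fun x => ?_)
  exact isClosed_le continuous_const (by fun_prop)

/-- A pointwise limit of completely positive maps is completely positive. -/
theorem IsCP.of_tendsto [Fintype B] {C : ℕ → SuperOp A B} {C' : SuperOp A B} (hC : ∀ n, IsCP (C n))
    (h : ∀ ρ, Filter.Tendsto (fun n => C n ρ) Filter.atTop (nhds (C' ρ))) : IsCP C' := by
  intro m ρ hρ
  suffices hlim : Filter.Tendsto (fun n => ampliation (C n) (Fin m) ρ) Filter.atTop
      (nhds (ampliation C' (Fin m) ρ)) from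
    isClosed_posSemidef.mem_of_tendsto hlim (Filter.Eventually.of_forall fun n => hC n m ρ hρ)
  refine tendsto_pi_nhds.2 fun y => tendsto_pi_nhds.2 fun z => ?_
  exact tendsto_pi_nhds.1 (tendsto_pi_nhds.1 (h _) _) _

variable [Fintype A]

theorem ampliation_conjBy (M : Matrix B A ℂ) (n : ℕ) (ρ : Matrix (A × Fin n) (A × Fin n) ℂ) :
    ampliation (conjBy M) (Fin n) ρ =
      Matrix.kroneckerMap (· * ·) M (1 : Matrix (Fin n) (Fin n) ℂ) * ρ *
        (Matrix.kroneckerMap (· * ·) M (1 : Matrix (Fin n) (Fin n) ℂ))ᴴ := by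
  ext ⟨b, i⟩ ⟨b', j⟩
  simp [ampliation, conjBy, sandwich, Matrix.mul_apply, Fintype.sum_prod_type, Matrix.one_apply,
    apply_ite (starRingEnd ℂ)]
  rfl

theorem IsCP.conjBy [Fintype B] (M : Matrix B A ℂ) : IsCP (conjBy M) := fun n ρ hρ => by
  rw [ampliation_conjBy]
  exact hρ.mul_mul_conjTranspose_same _

theorem IsQuantumOp.isCP [Fintype B] {C : SuperOp A B} (hC : IsQuantumOp C) : IsCP C :=
  hC.completelyPositive

theorem posSemidef_ketbra (ψ : A → ℂ) : (ketbra ψ).PosSemidef :=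
  Matrix.posSemidef_vecMulVec_self_star ψ

theorem conjBy_apply (M : Matrix B A ℂ) (ρ : Matrix A A ℂ) : conjBy M ρ = M * ρ * Mᴴ := rfl

theorem sandwich_apply (M : Matrix B A ℂ) (N : Matrix A B ℂ) (ρ : Matrix A A ℂ) :
    sandwich M N ρ = M * ρ * N := rfl

theorem conjBy_ketbra (M : Matrix B A ℂ) (ψ : A → ℂ) : conjBy M (ketbra ψ) = ketbra (M *ᵥ ψ) := by
  rw [conjBy_apply, ketbra, Matrix.mul_vecMulVec, Matrix.vecMulVec_mul, ketbra, Matrix.star_mulVec]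

theorem conjBy_comp [Fintype B] (M : Matrix D B ℂ) (N : Matrix B A ℂ) :
    conjBy M ∘ₗ conjBy N = conjBy (M * N) := by
  ext1 ρ
  simp [conjBy_apply, Matrix.mul_assoc, Matrix.conjTranspose_mul]

theorem trace_ketbra (ψ : A → ℂ) : (ketbra ψ).trace.re = ∑ a, ‖ψ a‖ ^ 2 := by
  simp [ketbra, Matrix.trace, Matrix.vecMulVec_apply, Complex.mul_conj, Complex.normSq_eq_norm_sq]
  norm_cast

/-- The entries of a positive semidefinite matrix are bounded by its trace. -/
theorem norm_apply_le_trace {ρ : Matrix A A ℂ} (hρ : ρ.PosSemidef) (a b : A) :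
    ‖ρ a b‖ ≤ ρ.trace.re := by
  obtain ⟨m, v, rfl⟩ := Matrix.posSemidef_iff_eq_sum_vecMulVec.1 hρ
  have htr : (∑ i, Matrix.vecMulVec (v i) (star (v i))).trace.re = ∑ i, ∑ c, ‖v i c‖ ^ 2 := by
    rw [Matrix.trace_sum, Complex.re_sum]
    exact Finset.sum_congr rfl fun i _ => trace_ketbra (v i)
  rw [htr, Matrix.sum_apply]
  refine (norm_sum_le _ _).trans (Finset.sum_le_sum fun i _ => ?_)
  have hle (c : A) : ‖v i c‖ ^ 2 ≤ ∑ c, ‖v i c‖ ^ 2 :=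
    Finset.single_le_sum (f := fun c => ‖v i c‖ ^ 2) (fun c _ => sq_nonneg _) (Finset.mem_univ c)
  rw [Matrix.vecMulVec_apply, norm_mul, Pi.star_apply, norm_star]
  -- The product of two moduli is at most the mean of their squares, and each square is at most the
  -- full sum, even when `a = b`.
  nlinarith [sq_nonneg (‖v i a‖ - ‖v i b‖), hle a, hle b]

theorem trace_re_nonneg {ρ : Matrix A A ℂ} (hρ : ρ.PosSemidef) : 0 ≤ ρ.trace.re :=
  (Complex.nonneg_iff.1 hρ.trace_nonneg).1

/-- Polarization: every operator is a combination of operators `|ψ⟩⟨ψ|`. -/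
theorem span_range_ketbra :
    Submodule.span ℂ (Set.range (ketbra : (A → ℂ) → Matrix A A ℂ)) = ⊤ := by
  classical
  rw [eq_top_iff]
  intro M _
  rw [Matrix.matrix_eq_sum_single M]
  refine Submodule.sum_mem _ fun a _ => Submodule.sum_mem _ fun b _ => ?_
  have hs : Matrix.single a b (M a b) =
      (M a b / 4) • (ketbra (Pi.single a 1 + Pi.single b 1) - ketbra (Pi.single a 1 - Pi.single b 1)
        + Complex.I • ketbra (Pi.single a 1 + Complex.I • Pi.single b 1)
        - Complex.I • ketbra (Pi.single a 1 - Complex.I • Pi.single b 1)) := by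
    ext i j
    simp only [Matrix.single_apply, ketbra, Matrix.smul_apply, Matrix.add_apply, Matrix.sub_apply,
      Matrix.vecMulVec_apply, Pi.star_apply, Pi.add_apply, Pi.sub_apply, Pi.smul_apply,
      Pi.single_apply, smul_eq_mul, star_add, star_sub, star_mul', Complex.star_def,
      Complex.conj_I, apply_ite (starRingEnd ℂ), map_one, map_zero]
    have h1 : Complex.I * Complex.I = -1 := Complex.I_mul_I
    by_cases h₁ : a = i <;> by_cases h₂ : b = j <;> by_cases h₃ : a = j <;> by_cases h₄ : b = i <;>
      simp [h₁, h₂, h₃, h₄, eq_comm] <;> grind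
  rw [hs]
  have hk (ψ : A → ℂ) : ketbra ψ ∈ Submodule.span ℂ (Set.range (ketbra (A := A))) :=
    Submodule.subset_span ⟨ψ, rfl⟩
  exact Submodule.smul_mem _ _ (Submodule.sub_mem _ (Submodule.add_mem _ (Submodule.sub_mem _
    (hk _) (hk _)) (Submodule.smul_mem _ _ (hk _))) (Submodule.smul_mem _ _ (hk _)))

theorem superOp_ext {C C' : SuperOp A B} (h : ∀ ψ, C (ketbra ψ) = C' (ketbra ψ)) : C = C' :=
  LinearMap.ext_on_range span_range_ketbra h

/-- The Löwner order on superoperators is antisymmetric. -/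
theorem LoewnerLE.antisymm [Fintype B] {C C' : SuperOp A B} (h : LoewnerLE C C') (h' : LoewnerLE C' C) :
    C = C' := by
  refine superOp_ext fun ψ => ?_
  -- The order only tests density matrices, so `|ψ⟩⟨ψ|` is first scaled by `1 / (1 + ‖ψ‖²)`; the
  -- added 1 covers `ψ = 0`.
  obtain ⟨c, hc, hcd⟩ : ∃ c : ℝ, 0 < c ∧ IsDensity ((c : ℂ) • ketbra ψ) := by
    have hn : 0 ≤ ∑ a, ‖ψ a‖ ^ 2 := Finset.sum_nonneg fun a _ => sq_nonneg _
    refine ⟨(1 + ∑ a, ‖ψ a‖ ^ 2)⁻¹, by positivity, (posSemidef_ketbra ψ).smul ?_, ?_⟩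
    · exact_mod_cast (by positivity : (0 : ℝ) ≤ (1 + ∑ a, ‖ψ a‖ ^ 2)⁻¹)
    · rw [Matrix.trace_smul, smul_eq_mul, Complex.re_ofReal_mul, trace_ketbra,
        inv_mul_le_one₀ (by positivity)]
      linarith
  have hd : IsDensity (((c : ℂ) • ketbra ψ).submatrix (Prod.fst : A × Fin 1 → A) Prod.fst) := by
    refine ⟨hcd.1.submatrix _, ?_⟩
    have : (((c : ℂ) • ketbra ψ).submatrix (Prod.fst : A × Fin 1 → A) Prod.fst).trace =
        ((c : ℂ) • ketbra ψ).trace := by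
      simp [Matrix.trace, Fintype.sum_prod_type]
    rw [this]; exact hcd.2
  have h1 : (C' ((c : ℂ) • ketbra ψ) - C ((c : ℂ) • ketbra ψ)).PosSemidef :=
    (h 1 _ hd).submatrix fun b => (b, 0)
  have h2 : (C ((c : ℂ) • ketbra ψ) - C' ((c : ℂ) • ketbra ψ)).PosSemidef :=
    (h' 1 _ hd).submatrix fun b => (b, 0)
  -- Opposite positive semidefinite matrices have trace zero, hence vanish.
  have h0 : C ((c : ℂ) • ketbra ψ) - C' ((c : ℂ) • ketbra ψ) = 0 := by
    refine h2.trace_eq_zero_iff.1 (le_antisymm ?_ h2.trace_nonneg)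
    have := h1.trace_nonneg
    rwa [← neg_sub, Matrix.trace_neg, Left.nonneg_neg_iff] at this
  rw [map_smul, map_smul, sub_eq_zero] at h0
  exact smul_right_injective _ (by exact_mod_cast hc.ne') h0

end CompletelyPositive

/-! ### Iteration of completely positive maps -/

section Iteration

variable {A : Type*} [Fintype A]

theorem trace_conjBy {B : Type*} [Fintype B] (M : Matrix B A ℂ) (ρ : Matrix A A ℂ) :
    (conjBy M ρ).trace = (Mᴴ * M * ρ).trace := by
  rw [conjBy_apply, Matrix.trace_mul_cycle]

/-- The map `ρ ↦ ∑ₙ E (Tⁿ ρ)`. -/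
structure IsIteration (E T C : SuperOp A A) : Prop where
  hasSum : ∀ ρ, HasSum (fun n : ℕ => E ((T ^ n : Module.End ℂ (Matrix A A ℂ)) ρ)) (C ρ)

variable {E T : SuperOp A A}

/-- Telescoping: the hypothesis at `Tᴺ ρ` says that the mass remaining after `N` steps pays for both
the next term and the next remainder. -/
theorem trace_iteration_le (hT : IsCP T)
    (htr : ∀ ρ : Matrix A A ℂ, ρ.PosSemidef → (E ρ).trace.re + (T ρ).trace.re ≤ ρ.trace.re)
    {ρ : Matrix A A ℂ} (hρ : ρ.PosSemidef) (N : ℕ) :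
    ∑ n ∈ Finset.range N, (E ((T ^ n : Module.End ℂ (Matrix A A ℂ)) ρ)).trace.re
      + ((T ^ N : Module.End ℂ (Matrix A A ℂ)) ρ).trace.re ≤ ρ.trace.re := by
  induction N with
  | zero => simp
  | succ N ih =>
    rw [Finset.sum_range_succ, pow_succ', Module.End.mul_apply]
    linarith [htr _ ((hT.pow N).map_posSemidef hρ)]

/-- By polarization it suffices to treat `|ψ⟩⟨ψ|`. There the terms are positive, their traces have
bounded partial sums, and the traces dominate the entries. -/
theorem summable_iteration (hE : IsCP E) (hT : IsCP T)
    (htr : ∀ ρ : Matrix A A ℂ, ρ.PosSemidef → (E ρ).trace.re + (T ρ).trace.re ≤ ρ.trace.re)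
    (ρ : Matrix A A ℂ) :
    Summable (fun n : ℕ => E ((T ^ n : Module.End ℂ (Matrix A A ℂ)) ρ)) := by
  have hρ : ρ ∈ Submodule.span ℂ (Set.range (ketbra (A := A))) := by
    rw [span_range_ketbra]; trivial
  induction hρ using Submodule.span_induction with
  | mem ρ h =>
    obtain ⟨ψ, rfl⟩ := h
    have hpos := posSemidef_ketbra ψ
    have hEn (n : ℕ) := hE.map_posSemidef ((hT.pow n).map_posSemidef hpos)
    have hs : Summable fun n : ℕ =>
        (E ((T ^ n : Module.End ℂ (Matrix A A ℂ)) (ketbra ψ))).trace.re := by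
      refine summable_of_sum_range_le (fun n => trace_re_nonneg (hEn n))
        (c := (ketbra ψ).trace.re) fun N => ?_
      linarith [trace_iteration_le hT htr hpos N,
        trace_re_nonneg ((hT.pow N).map_posSemidef hpos)]
    exact Pi.summable.2 fun a => Pi.summable.2 fun b =>
      Summable.of_norm_bounded hs fun n => norm_apply_le_trace (hEn n) a b
  | zero => simp
  | add ρ σ _ _ h₁ h₂ => simpa using h₁.add h₂
  | smul c ρ _ h => simpa using h.const_smul c

theorem exists_isIteration (hE : IsCP E) (hT : IsCP T)
    (htr : ∀ ρ : Matrix A A ℂ, ρ.PosSemidef → (E ρ).trace.re + (T ρ).trace.re ≤ ρ.trace.re) :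
    ∃ C, IsIteration E T C := by
  have hs := summable_iteration hE hT htr
  refine ⟨{ toFun := fun ρ => ∑' n : ℕ, E ((T ^ n : Module.End ℂ (Matrix A A ℂ)) ρ)
            map_add' := fun ρ σ => ?_
            map_smul' := fun c ρ => ?_ }, ⟨fun ρ => (hs ρ).hasSum⟩⟩
  · simp only [map_add]
    exact (hs ρ).tsum_add (hs σ)
  · simp only [map_smul, RingHom.id_apply]
    exact (hs ρ).tsum_const_smul c

namespace IsIteration

variable {C : SuperOp A A} (h : IsIteration E T C)
include h

-- The series at `ρ` without its term `n = 0` is the series at `T ρ`.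
omit [Fintype A] in
theorem fixed : E + C ∘ₗ T = C := by
  ext1 ρ
  have h₁ := h.hasSum ρ
  rw [← hasSum_nat_add_iff' 1] at h₁
  simp only [Finset.range_one, Finset.sum_singleton, pow_zero, Module.End.one_apply,
    pow_succ, Module.End.mul_apply] at h₁
  have := (h.hasSum (T ρ)).unique h₁
  simp [this]

theorem isCP (hE : IsCP E) (hT : IsCP T) : IsCP C := by
  refine IsCP.of_tendsto (C := fun N => ∑ n ∈ Finset.range N, E ∘ₗ (T ^ n : Module.End ℂ _))
    (fun N => ?_) fun ρ => ?_
  · induction N with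
    | zero => exact IsCP.zero
    | succ N ih => rw [Finset.sum_range_succ]; exact ih.add (hE.comp (hT.pow N))
  · simpa using (h.hasSum ρ).tendsto_sum_nat

theorem trace_le (hT : IsCP T)
    (htr : ∀ ρ : Matrix A A ℂ, ρ.PosSemidef → (E ρ).trace.re + (T ρ).trace.re ≤ ρ.trace.re)
    {ρ : Matrix A A ℂ} (hρ : ρ.PosSemidef) : (C ρ).trace.re ≤ ρ.trace.re := by
  have hc : Continuous fun ρ : Matrix A A ℂ => ρ.trace.re := by fun_prop
  refine le_of_tendsto ((hc.tendsto _).comp (h.hasSum ρ).tendsto_sum_nat)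
    (Filter.Eventually.of_forall fun N => ?_)
  simp only [Function.comp_apply, Matrix.trace_sum, Complex.re_sum]
  linarith [trace_iteration_le hT htr hρ N, trace_re_nonneg ((hT.pow N).map_posSemidef hρ)]

/-- The iteration lies below every completely positive solution of its fixed point equation. -/
theorem isCP_sub (hT : IsCP T) {D : SuperOp A A} (hD : IsCP D) (hfix : E + D ∘ₗ T = D) :
    IsCP (D - C) := by
  -- Unrolling the fixed point equation `N` times leaves `D ∘ Tᴺ` as the difference between `D` and
  -- a partial sum. It is completely positive for each `N`, and so is the limit, which need not be
  -- zero.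
  have hN (N : ℕ) : ∑ n ∈ Finset.range N, E ∘ₗ (T ^ n : Module.End ℂ _)
      + D ∘ₗ (T ^ N : Module.End ℂ _) = D := by
    induction N with
    | zero => ext1 ρ; simp
    | succ N ih =>
      rw [Finset.sum_range_succ, add_assoc]
      conv_rhs => rw [← ih]
      congr 1
      ext1 ρ
      simp only [pow_succ', LinearMap.add_apply, LinearMap.comp_apply, Module.End.mul_apply]
      conv_rhs => rw [← hfix]
      rfl
  refine IsCP.of_tendsto (C := fun N => D ∘ₗ (T ^ N : Module.End ℂ _))
    (fun N => hD.comp (hT.pow N)) fun ρ => ?_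
  have hlim := (h.hasSum ρ).tendsto_sum_nat.const_sub (D ρ)
  refine hlim.congr fun N => ?_
  have := congrArg (fun C : SuperOp A A => C ρ) (hN N)
  simp only [LinearMap.add_apply, LinearMap.sum_apply, LinearMap.comp_apply] at this ⊢
  rw [sub_eq_iff_eq_add', this]

end IsIteration

end Iteration

/-! ### Vacuum extensions -/

section VacuumExtension

variable {A B : Type*} [Fintype A] [DecidableEq A] [Fintype B] [DecidableEq B]

/-- The inclusion of a space into its sum with the vacuum. -/
def inclVac (A : Type*) [DecidableEq A] : Matrix (A ⊕ Unit) A ℂ := Matrix.fromRows 1 0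

theorem conjBy_inclVac (ρ : Matrix A A ℂ) :
    conjBy (inclVac A) ρ = Matrix.fromBlocks ρ 0 0 0 := by
  ext i j
  rcases i with i | i <;> rcases j with j | j <;>
    simp [conjBy_apply, inclVac, Matrix.mul_apply, Matrix.one_apply]

theorem conjBy_inclVac_conjTranspose (ρ : Matrix (A ⊕ Unit) (A ⊕ Unit) ℂ) :
    conjBy (inclVac A)ᴴ ρ = ρ.toBlocks₁₁ := by
  ext i j
  simp [conjBy_apply, inclVac, Matrix.mul_apply, Matrix.one_apply, Matrix.toBlocks₁₁]

theorem vacuumExt_sub (C C' : SuperOp A B) (F : Matrix B A ℂ) :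
    vacuumExt C F - vacuumExt C' F = conjBy (inclVac B) ∘ₗ (C - C') ∘ₗ conjBy (inclVac A)ᴴ := by
  ext1 ρ
  simp only [LinearMap.sub_apply, LinearMap.comp_apply, conjBy_inclVac,
    conjBy_inclVac_conjTranspose]
  ext i j
  rcases i with i | i <;> rcases j with j | j <;> simp [vacuumExt]

omit [DecidableEq A] [Fintype B] [DecidableEq B] in
theorem vacuumExt_conjBy (F : Matrix B A ℂ) :
    vacuumExt (conjBy F) F = conjBy (Matrix.fromBlocks F 0 0 1) := by
  ext1 ρ
  rw [conjBy_apply, Matrix.fromBlocks_conjTranspose]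
  conv_rhs => rw [← Matrix.fromBlocks_toBlocks ρ]
  simp [vacuumExt, Matrix.fromBlocks_multiply, conjBy_apply]

theorem loewnerLE_vacuumExt {C C' : SuperOp A B} (F : Matrix B A ℂ) (h : IsCP (C' - C)) :
    LoewnerLE (vacuumExt C F) (vacuumExt C' F) := by
  have hcp : IsCP (vacuumExt C' F - vacuumExt C F) := by
    rw [vacuumExt_sub]
    exact (IsCP.conjBy _).comp (h.comp (IsCP.conjBy _))
  exact fun n ρ hρ => hcp n ρ hρ.1

omit [DecidableEq A] [Fintype B] [DecidableEq B] in
theorem vacuumExt_injective {C C' : SuperOp A B} {F F' : Matrix B A ℂ}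
    (h : vacuumExt C F = vacuumExt C' F') : C = C' := by
  ext1 ρ
  have := congrArg (fun D : SuperOp _ _ => (D (Matrix.fromBlocks ρ 0 0 0)).toBlocks₁₁) h
  simpa [vacuumExt] using this

/-- The map `𝒞` is trace non-increasing and `𝒞 - F (·) F†` is completely positive. -/
structure IsVacuumPair (C : SuperOp A B) (F : Matrix B A ℂ) : Prop where
  isCP_sub : IsCP (C - conjBy F)
  trace_le : ∀ ρ : Matrix A A ℂ, ρ.PosSemidef → (C ρ).trace.re ≤ ρ.trace.re

namespace IsVacuumPair

omit [DecidableEq A] [DecidableEq B] in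
theorem isCP {C : SuperOp A B} {F : Matrix B A ℂ} (h : IsVacuumPair C F) : IsCP C := by
  simpa using h.isCP_sub.add (IsCP.conjBy F)

omit [DecidableEq A] [DecidableEq B] in
theorem isQuantumOp {C : SuperOp A B} {F : Matrix B A ℂ} (h : IsVacuumPair C F) :
    IsQuantumOp C := ⟨h.isCP, h.trace_le⟩

theorem isQuantumOp_vacuumExt {C : SuperOp A B} {F : Matrix B A ℂ} (h : IsVacuumPair C F) :
    IsQuantumOp (vacuumExt C F) := by
  refine ⟨?_, fun ρ hρ => ?_⟩
  · have := vacuumExt_sub C (conjBy F) F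
    rw [sub_eq_iff_eq_add, vacuumExt_conjBy] at this
    rw [this]
    exact ((IsCP.conjBy _).comp (h.isCP_sub.comp (IsCP.conjBy _))).add (IsCP.conjBy _)
  · have h₁ : ρ.trace = ρ.toBlocks₁₁.trace + ρ.toBlocks₂₂.trace := by
      simp [Matrix.trace, Matrix.toBlocks₁₁, Matrix.toBlocks₂₂]
    have h₂ : (vacuumExt C F ρ).trace = (C ρ.toBlocks₁₁).trace + ρ.toBlocks₂₂.trace := by
      simp [vacuumExt, Matrix.trace, Matrix.toBlocks₂₂]
    rw [h₁, h₂, Complex.add_re, Complex.add_re]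
    have hpos : (ρ.toBlocks₁₁).PosSemidef := hρ.submatrix Sum.inl
    have := h.trace_le _ hpos
    linarith

end IsVacuumPair

omit [DecidableEq B] in
theorem isVacuumPair_conjBy {F : Matrix B A ℂ} (hF : Fᴴ * F = 1) :
    IsVacuumPair (conjBy F) F := by
  refine ⟨by rw [sub_self]; exact IsCP.zero, fun ρ _ => ?_⟩
  rw [trace_conjBy, hF, Matrix.one_mul]

end VacuumExtension

variable {X : Type u} [DecidableEq X]

/-! ### One-qubit operators -/

/-- The restriction of a basis state of `q, Γ` to `Γ`. -/
def Ext.restrict {q : X} {Γ Γ₁ : Finset X} (h : Ext q Γ Γ₁) (y : Basis Γ₁) : Basis Γ :=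
  fun p => y ⟨p.1, h.subset p.2⟩

/-- The basis state of `q, Γ` with the bit `b` at `q`. -/
def Ext.extend {q : X} {Γ Γ₁ : Finset X} (_ : Ext q Γ Γ₁) (b : Fin 2) (x : Basis Γ) : Basis Γ₁ :=
  fun p => if hp : p.1 ∈ Γ then x ⟨p.1, hp⟩ else b

theorem Ext.extend_eq_iff {q : X} {Γ Γ₁ : Finset X} (h : Ext q Γ Γ₁) {b : Fin 2} {x : Basis Γ}
    {y : Basis Γ₁} : y = h.extend b x ↔ y ⟨q, h.mem⟩ = b ∧ h.restrict y = x := by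
  constructor
  · rintro rfl
    refine ⟨by simp [extend, h.notMem], funext fun p => by simp [extend, restrict]⟩
  · rintro ⟨h₁, rfl⟩
    funext ⟨p, hp⟩
    by_cases hpΓ : p ∈ Γ
    · simp [extend, restrict, hpΓ]
    · obtain rfl : p = q := by
        rw [h.eq_insert, Finset.mem_insert] at hp
        exact hp.resolve_right hpΓ
      simp [extend, hpΓ, h₁]

theorem ket_apply {q : X} {Γ Γ₁ : Finset X} (h : Ext q Γ Γ₁) (b : Fin 2) (y : Basis Γ₁)
    (x : Basis Γ) : ket h b y x = if y = h.extend b x then 1 else 0 := by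
  simp only [ket, h.extend_eq_iff, funext_iff, Ext.restrict]

theorem bra_mul_ket {q : X} {Γ Γ₁ : Finset X} (h : Ext q Γ Γ₁) (b c : Fin 2) :
    bra h b * ket h c = if b = c then 1 else 0 := by
  ext x y
  have heq : h.extend b x = h.extend c y ↔ b = c ∧ x = y := by
    rw [h.extend_eq_iff]
    obtain ⟨h₁, h₂⟩ := h.extend_eq_iff.1 (rfl : h.extend b x = _)
    rw [h₁, h₂]
  simp only [bra, Matrix.mul_apply, Matrix.conjTranspose_apply, ket_apply, apply_ite star,
    star_one, star_zero, ite_mul, one_mul, zero_mul, Finset.sum_ite_eq',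
    Finset.mem_univ, if_true, heq]
  by_cases hbc : b = c <;> simp [hbc, Matrix.one_apply]

theorem conjTranspose_bra {q : X} {Γ Γ₁ : Finset X} (h : Ext q Γ Γ₁) (b : Fin 2) :
    (bra h b)ᴴ = ket h b := Matrix.conjTranspose_conjTranspose _

theorem conjTranspose_ket {q : X} {Γ Γ₁ : Finset X} (h : Ext q Γ Γ₁) (b : Fin 2) :
    (ket h b)ᴴ = bra h b := rfl

theorem ket_mul_bra_add {q : X} {Γ Γ₁ : Finset X} (h : Ext q Γ Γ₁) :
    ket h 0 * bra h 0 + ket h 1 * bra h 1 = 1 := by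
  rw [← Fin.sum_univ_two fun b => ket h b * bra h b]
  ext y z
  have hyz : y ⟨q, h.mem⟩ = z ⟨q, h.mem⟩ ∧ h.restrict y = h.restrict z ↔ y = z := by
    refine ⟨fun h' => (h.extend_eq_iff.2 h').trans (h.extend_eq_iff.2 ⟨rfl, rfl⟩).symm, ?_⟩
    rintro rfl; exact ⟨rfl, rfl⟩
  simp only [bra, Matrix.sum_apply, Matrix.mul_apply, Matrix.conjTranspose_apply, ket_apply,
    h.extend_eq_iff, Matrix.one_apply, ← hyz, apply_ite star, star_one, star_zero, mul_ite,
    mul_one, mul_zero, ite_and]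
  rw [Finset.sum_comm]
  simp

theorem proj_mul_proj {q : X} {Γ : Finset X} (h : q ∈ Γ) (b : Fin 2) :
    (proj h b)ᴴ * proj h b = proj h b := by
  simp [proj, Matrix.diagonal_conjTranspose]

omit [DecidableEq X] in
theorem proj_add_proj {q : X} {Γ : Finset X} (h : q ∈ Γ) : proj h 0 + proj h 1 = 1 := by
  rw [proj, proj, Matrix.diagonal_add, ← Matrix.diagonal_one]
  congr 1
  funext x
  have (b : Fin 2) : (if b = 0 then 1 else 0) + (if b = 1 then 1 else 0) = (1 : ℂ) := by
    fin_cases b <;> simp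
  exact this _

theorem gateOp_mul {q : X} {Γ : Finset X} (h : q ∈ Γ) (U V : Matrix (Fin 2) (Fin 2) ℂ) :
    gateOp h U * gateOp h V = gateOp h (U * V) := by
  ext y x
  rw [Matrix.mul_apply]
  have he : Function.Injective fun b : Fin 2 => Function.update x ⟨q, h⟩ b :=
    Function.update_injective x _
  -- Only intermediate basis states agreeing with `x` away from `q` contribute, so the sum reduces
  -- to one over the bit at `q`.
  rw [← Fintype.sum_of_injective _ he (fun b => (if ∀ p : {p : X // p ∈ Γ}, p.1 ≠ q → y p = x p then
    U (y ⟨q, h⟩) b * V b (x ⟨q, h⟩) else 0))]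
  · simp only [gateOp]
    split_ifs <;> simp [Matrix.mul_apply]
  · intro z hz
    have : ¬ ∀ p : {p : X // p ∈ Γ}, p.1 ≠ q → z p = x p := by
      refine fun hzx => hz ⟨z ⟨q, h⟩, funext fun p => ?_⟩
      by_cases hp : p = ⟨q, h⟩
      · subst hp; simp
      · simpa [hp] using (hzx p fun h' => hp (Subtype.ext h')).symm
    simp only [gateOp, if_neg this, mul_zero]
  · intro b
    have h₁ : ∀ p : {p : X // p ∈ Γ}, p.1 ≠ q → Function.update x ⟨q, h⟩ b p = x p :=
      fun p hp => Function.update_of_ne (fun h' => hp (congrArg Subtype.val h')) _ _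
    have h₂ : (∀ p : {p : X // p ∈ Γ}, p.1 ≠ q → y p = Function.update x ⟨q, h⟩ b p) ↔
        ∀ p : {p : X // p ∈ Γ}, p.1 ≠ q → y p = x p :=
      forall₂_congr fun p hp => by rw [h₁ p hp]
    simp only [gateOp, if_pos h₁, h₂, Function.update_self, ite_mul, zero_mul]

theorem gateOp_conjTranspose {q : X} {Γ : Finset X} (h : q ∈ Γ) (U : Matrix (Fin 2) (Fin 2) ℂ) :
    (gateOp h U)ᴴ = gateOp h Uᴴ := by
  ext y x
  simp only [gateOp, Matrix.conjTranspose_apply, eq_comm, apply_ite star, star_zero]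

theorem gateOp_one {q : X} {Γ : Finset X} (h : q ∈ Γ) : gateOp h 1 = 1 := by
  ext y x
  have : y = x ↔ (∀ p : {p : X // p ∈ Γ}, p.1 ≠ q → y p = x p) ∧ y ⟨q, h⟩ = x ⟨q, h⟩ := by
    refine ⟨by rintro rfl; simp, fun ⟨h₁, h₂⟩ => funext fun p => ?_⟩
    by_cases hp : p.1 = q
    · obtain ⟨p, hpΓ⟩ := p
      subst hp; exact h₂
    · exact h₁ p hp
  simp only [gateOp, Matrix.one_apply, this, ite_and]

theorem gateOp_isometry {q : X} {Γ : Finset X} (h : q ∈ Γ) (U : Matrix.unitaryGroup (Fin 2) ℂ) :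
    (gateOp h U.1)ᴴ * gateOp h U.1 = 1 := by
  rw [gateOp_conjTranspose, gateOp_mul]
  rw [show U.1ᴴ * U.1 = 1 from Matrix.mem_unitaryGroup_iff'.1 U.2, gateOp_one]

theorem trace_conjBy_bra_add {q : X} {Γ Γ₁ : Finset X} (h : Ext q Γ Γ₁)
    (ρ : Matrix (Basis Γ₁) (Basis Γ₁) ℂ) :
    (conjBy (bra h 0) ρ).trace.re + (conjBy (bra h 1) ρ).trace.re = ρ.trace.re := by
  rw [trace_conjBy, trace_conjBy, ← Complex.add_re, ← Matrix.trace_add, ← Matrix.add_mul,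
    conjTranspose_bra, conjTranspose_bra, ket_mul_bra_add, Matrix.one_mul]

theorem trace_conjBy_proj_add {q : X} {Γ : Finset X} (h : q ∈ Γ)
    (ρ : Matrix (Basis Γ) (Basis Γ) ℂ) :
    (conjBy (proj h 0) ρ).trace.re + (conjBy (proj h 1) ρ).trace.re = ρ.trace.re := by
  rw [trace_conjBy, trace_conjBy, ← Complex.add_re, ← Matrix.trace_add, ← Matrix.add_mul,
    proj_mul_proj, proj_mul_proj, proj_add_proj, Matrix.one_mul]

/-- Interference terms do not affect the trace: after a cyclic permutation, `⟨c|_q` meets `|b⟩_q`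
with `b ≠ c`. -/
theorem trace_sandwich_ket {q : X} {Γ Γ₁ Δ Δ₁ : Finset X} (hΓ : Ext q Γ Γ₁) (hΔ : Ext q Δ Δ₁)
    {b c : Fin 2} (hbc : b ≠ c) (F G : Op Γ Δ) (ρ : Matrix (Basis Γ₁) (Basis Γ₁) ℂ) :
    (sandwich (ket hΔ b * F * bra hΓ b) (ket hΔ c * G * bra hΓ c)ᴴ ρ).trace = 0 := by
  rw [sandwich_apply, Matrix.trace_mul_comm, ← Matrix.mul_assoc]
  simp only [Matrix.conjTranspose_mul, conjTranspose_bra, conjTranspose_ket]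
  have : bra hΔ c * (ket hΔ b * F * bra hΓ b) = 0 := by
    rw [← Matrix.mul_assoc, ← Matrix.mul_assoc, bra_mul_ket, if_neg hbc.symm, Matrix.zero_mul,
      Matrix.zero_mul]
  rw [Matrix.mul_assoc (ket hΓ c), Matrix.mul_assoc (Gᴴ), this]
  simp

/-! ### Denotations are vacuum pairs -/

section Constructors

variable {Γ Γ' Γ'' : Finset X}

theorem IsVacuumPair.comp {p : Den Γ' Γ''} {r : Den Γ Γ'} (hp : IsVacuumPair p.1 p.2)
    (hr : IsVacuumPair r.1 r.2) : IsVacuumPair (p.comp r).1 (p.comp r).2 := by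
  refine ⟨?_, fun ρ hρ => (hp.trace_le _ (hr.isCP.map_posSemidef hρ)).trans (hr.trace_le _ hρ)⟩
  -- The two factors are replaced by their conjugation parts one at a time.
  have : (p.comp r).1 - conjBy (p.comp r).2 =
      (p.1 - conjBy p.2) ∘ₗ r.1 + conjBy p.2 ∘ₗ (r.1 - conjBy r.2) := by
    rw [Den.comp, ← conjBy_comp]
    simp only [LinearMap.sub_comp, LinearMap.comp_sub]
    abel
  rw [this]
  exact (hp.isCP_sub.comp hr.isCP).add ((IsCP.conjBy _).comp hr.isCP_sub)

theorem IsVacuumPair.meas {q : X} (h : q ∈ Γ) {p₀ p₁ : Den Γ Γ'} (h₀ : IsVacuumPair p₀.1 p₀.2)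
    (h₁ : IsVacuumPair p₁.1 p₁.2) :
    IsVacuumPair (Den.meas h p₀ p₁).1 (Den.meas h p₀ p₁).2 := by
  refine ⟨?_, fun ρ hρ => ?_⟩
  · have : (Den.meas h p₀ p₁).1 - conjBy (Den.meas h p₀ p₁).2 =
        (p₀.1 - conjBy p₀.2) ∘ₗ conjBy (proj h 0) + p₁.1 ∘ₗ conjBy (proj h 1) := by
      rw [Den.meas, ← conjBy_comp]
      simp only [LinearMap.sub_comp]
      abel
    rw [this]
    exact (h₀.isCP_sub.comp (IsCP.conjBy _)).add (h₁.isCP.comp (IsCP.conjBy _))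
  · rw [← trace_conjBy_proj_add h ρ]
    simp only [Den.meas, LinearMap.add_apply, LinearMap.comp_apply, Matrix.trace_add,
      Complex.add_re]
    exact add_le_add (h₀.trace_le _ ((IsCP.conjBy _).map_posSemidef hρ))
      (h₁.trace_le _ ((IsCP.conjBy _).map_posSemidef hρ))

theorem IsVacuumPair.qcase {q : X} {Γ Γ₁ Δ Δ₁ : Finset X} (hΓ : Ext q Γ Γ₁) (hΔ : Ext q Δ Δ₁)
    {p₀ p₁ : Den Γ Δ} (h₀ : IsVacuumPair p₀.1 p₀.2) (h₁ : IsVacuumPair p₁.1 p₁.2) :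
    IsVacuumPair (Den.qcase hΓ hΔ p₀ p₁).1 (Den.qcase hΓ hΔ p₀ p₁).2 := by
  refine ⟨?_, fun ρ hρ => ?_⟩
  -- Expanding `(G₀ + G₁)(·)(G₀ + G₁)†` produces exactly the two interference terms, which cancel.
  · have : (Den.qcase hΓ hΔ p₀ p₁).1 - conjBy (Den.qcase hΓ hΔ p₀ p₁).2 =
        conjBy (ket hΔ 0) ∘ₗ (p₀.1 - conjBy p₀.2) ∘ₗ conjBy (bra hΓ 0)
          + conjBy (ket hΔ 1) ∘ₗ (p₁.1 - conjBy p₁.2) ∘ₗ conjBy (bra hΓ 1) := by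
      simp only [LinearMap.sub_comp, LinearMap.comp_sub, conjBy_comp, ← Matrix.mul_assoc]
      ext1 ρ
      simp only [Den.qcase, LinearMap.add_apply, LinearMap.sub_apply, conjBy_apply, sandwich_apply,
        Matrix.conjTranspose_add, Matrix.add_mul, Matrix.mul_add]
      abel
    rw [this]
    exact ((IsCP.conjBy _).comp (h₀.isCP_sub.comp (IsCP.conjBy _))).add
      ((IsCP.conjBy _).comp (h₁.isCP_sub.comp (IsCP.conjBy _)))
  · have hket (b : Fin 2) (σ : Matrix (Basis Δ) (Basis Δ) ℂ) :
        (conjBy (ket hΔ b) σ).trace = σ.trace := by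
      rw [trace_conjBy, conjTranspose_ket, bra_mul_ket, if_pos rfl, Matrix.one_mul]
    rw [← trace_conjBy_bra_add hΓ ρ]
    simp only [Den.qcase, LinearMap.add_apply, LinearMap.comp_apply, Matrix.trace_add,
      Complex.add_re, trace_sandwich_ket hΓ hΔ zero_ne_one, trace_sandwich_ket hΓ hΔ one_ne_zero,
      hket, add_zero]
    exact add_le_add (h₀.trace_le _ ((IsCP.conjBy _).map_posSemidef hρ))
      (h₁.trace_le _ ((IsCP.conjBy _).map_posSemidef hρ))

/-- The functional whose least fixed point interprets a loop. -/
def Den.loop {q : X} (h : q ∈ Γ) (b p : Den Γ Γ) : Den Γ Γ := Den.meas h (Den.id Γ) (p.comp b)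

/-- The matrix of a measurement sees only branch 0, which is the identity here, so the fixed point
equation determines `F` outright and is affine in the first component. -/
theorem Den.loop_eq_iff {q : X} (h : q ∈ Γ) (b p : Den Γ Γ) : Den.loop h b p = p ↔
    conjBy (proj h 0) + p.1 ∘ₗ (b.1 ∘ₗ conjBy (proj h 1)) = p.1 ∧ proj h 0 = p.2 := by
  rw [Prod.ext_iff]
  simp [Den.loop, Den.meas, Den.id, Den.comp, LinearMap.comp_assoc]

/-- The least fixed point of a loop is given by iteration of its body. -/
theorem exists_isIteration_loop {q : X} (h : q ∈ Γ) {b : Den Γ Γ} (hb : IsVacuumPair b.1 b.2) :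
    ∃ C, IsIteration (conjBy (proj h 0)) (b.1 ∘ₗ conjBy (proj h 1)) C ∧
      IsVacuumPair C (proj h 0) ∧ lfp (Den.loop h b) = (C, proj h 0) := by
  have hE : IsCP (conjBy (proj h 0)) := IsCP.conjBy _
  have hT : IsCP (b.1 ∘ₗ conjBy (proj h 1)) := hb.isCP.comp (IsCP.conjBy _)
  have htr : ∀ ρ : Matrix (Basis Γ) (Basis Γ) ℂ, ρ.PosSemidef → (conjBy (proj h 0) ρ).trace.re
      + ((b.1 ∘ₗ conjBy (proj h 1)) ρ).trace.re ≤ ρ.trace.re := fun ρ hρ => by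
    rw [← trace_conjBy_proj_add h ρ]
    exact add_le_add_right (hb.trace_le _ ((IsCP.conjBy _).map_posSemidef hρ)) _
  obtain ⟨C, hC⟩ := exists_isIteration hE hT htr
  have hV : IsVacuumPair C (proj h 0) := by
    refine ⟨?_, fun ρ hρ => hC.trace_le hT htr hρ⟩
    -- By the fixed point equation, what remains after subtracting the projection is `C ∘ T`.
    rw [← hC.fixed, add_sub_cancel_left]
    exact (hC.isCP hE hT).comp hT
  refine ⟨C, hC, hV, ?_⟩
  have hlfp : IsLfp (Den.loop h b) (C, proj h 0) := by
    refine ⟨⟨hV.isQuantumOp, hV.isQuantumOp_vacuumExt⟩,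
      (Den.loop_eq_iff h b _).2 ⟨hC.fixed, rfl⟩, fun r hr hfix => ?_⟩
    obtain ⟨r, F⟩ := r
    obtain ⟨h₁, rfl⟩ := (Den.loop_eq_iff h b _).1 hfix
    exact loewnerLE_vacuumExt _ (hC.isCP_sub hT hr.1.isCP h₁)
  have hex : ∃ p, IsLfp (Den.loop h b) p := ⟨_, hlfp⟩
  rw [lfp, dif_pos hex]
  have hs := hex.choose_spec
  refine Prod.ext ?_ ((Den.loop_eq_iff h b _).1 hs.2.1).2.symm
  -- The chosen least fixed point and the iteration lie below each other, so the choice made in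
  -- `lfp` is immaterial.
  exact vacuumExt_injective (LoewnerLE.antisymm (hs.2.2 _ hlfp.1 hlfp.2.1)
    (hlfp.2.2 _ hs.1 hs.2.1))

end Constructors

theorem isVacuumPair_den {Γ Δ : Finset X} {S : Stmt X} (t : Typing Γ S Δ) :
    IsVacuumPair (den t).1 (den t).2 := by
  induction t with
  | @skip Γ =>
    have := isVacuumPair_conjBy (F := (1 : Op Γ Γ)) (by simp)
    have hid : (LinearMap.id : SuperOp (Basis Γ) (Basis Γ)) = conjBy 1 := by
      ext1 ρ; simp [conjBy_apply]
    rw [den, Den.id, hid]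
    exact this
  | newQbit h =>
    rw [den]
    exact isVacuumPair_conjBy (by rw [conjTranspose_ket, bra_mul_ket, if_pos rfl])
  | discard h =>
    rw [den]
    refine ⟨by rw [add_sub_cancel_left]; exact IsCP.conjBy _, fun ρ _ => ?_⟩
    rw [LinearMap.add_apply, Matrix.trace_add, Complex.add_re, trace_conjBy_bra_add]
  | gate h => rw [den]; exact isVacuumPair_conjBy (gateOp_isometry h _)
  | seq t₀ t₁ ih₀ ih₁ => rw [den]; exact ih₁.comp ih₀
  | meas h t₀ t₁ ih₀ ih₁ => rw [den]; exact ih₀.meas h ih₁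
  | whileDo h t ih =>
    obtain ⟨C, -, hV, hl⟩ := exists_isIteration_loop h ih
    rw [den]
    change IsVacuumPair (lfp (Den.loop h (den t))).1 (lfp (Den.loop h (den t))).2
    rw [hl]
    exact hV
  | qcase hΓ hΔ t₀ t₁ hq ih₀ ih₁ => rw [den]; exact ih₀.qcase hΓ hΔ ih₁

/-! ### Sums of projectors -/

theorem hasSum_superOp {A B ι : Type*} [Fintype A] [Fintype B] (C : SuperOp A B)
    {f : ι → Matrix A A ℂ} {ρ : Matrix A A ℂ} (h : HasSum f ρ) :
    HasSum (fun i => C (f i)) (C ρ) :=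
  h.map C C.continuous_of_finiteDimensional

theorem hasSum_trace_re {A ι : Type*} [Fintype A] {f : ι → Matrix A A ℂ} {ρ : Matrix A A ℂ}
    (h : HasSum f ρ) : HasSum (fun i => (f i).trace.re) ρ.trace.re :=
  h.map (Complex.reAddGroupHom.comp (Matrix.traceAddMonoidHom A ℂ))
    (Complex.continuous_re.comp (by fun_prop : Continuous fun ρ : Matrix A A ℂ => ρ.trace))

/-- Iterated sums do not in general give unconditional sums over pairs. Here Tonelli applies to the
nonnegative traces, and these dominate the entries. -/
theorem hasSum_ketbra_sigma {A ι : Type*} [Fintype A] {κ : ι → Type*} {f : (Σ i, κ i) → A → ℂ}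
    {g : ι → Matrix A A ℂ} {ρ : Matrix A A ℂ}
    (h : ∀ i, HasSum (fun k => ketbra (f ⟨i, k⟩)) (g i)) (hg : HasSum g ρ) :
    HasSum (fun p => ketbra (f p)) ρ := by
  have hs : Summable fun p => (ketbra (f p)).trace.re := by
    refine (summable_sigma_of_nonneg fun p => trace_re_nonneg (posSemidef_ketbra _)).2
      ⟨fun i => (hasSum_trace_re (h i)).summable, ?_⟩
    exact (hasSum_trace_re hg).summable.congr fun i => (hasSum_trace_re (h i)).tsum_eq.symm
  refine hg.sigma_of_hasSum h (Pi.summable.2 fun a => Pi.summable.2 fun b => ?_)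
  exact Summable.of_norm_bounded hs fun p => norm_apply_le_trace (posSemidef_ketbra _) a b

@[simp] theorem ketbra_zero {A : Type*} : ketbra (0 : A → ℂ) = 0 := by
  simp [ketbra]

theorem ketbra_add {A : Type*} (φ χ : A → ℂ) : ketbra (φ + χ) = ketbra φ + ketbra χ
    + (Matrix.vecMulVec φ (star χ) + Matrix.vecMulVec χ (star φ)) := by
  simp only [ketbra, star_add, Matrix.add_vecMulVec, Matrix.vecMulVec_add]
  abel

theorem ketbra_bit_smul {A : Type*} (ν : Bool) (φ : A → ℂ) :
    ketbra (bit ν • φ) = bit ν • ketbra φ := by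
  cases ν <;> simp [bit]

/-! ### Derivations -/

/-- The derivations of transitions from a configuration, with their values. -/
abbrev Outcome {Γ Δ : Finset X} {S : Stmt X} (t : Typing Γ S Δ) (ψ : Hilb Γ) : Type u :=
  Σ v : Hilb Δ × Bool, Exec t ψ v.1 v.2

/-- The number of iterations of the loop that ends a derivation. -/
noncomputable def Exec.iterations : {Γ Δ : Finset X} → {S : Stmt X} → {t : Typing Γ S Δ} →
    {ψ : Hilb Γ} → {φ : Hilb Δ} → {ν : Bool} → Exec t ψ φ ν → ℕ
  | _, _, _, _, _, _, _, .while₁ _ d => d.iterations + 1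
  -- Only the second part counts: in the premise of `while₁` the first part is a run of the body,
  -- whose own loops must be ignored.
  | _, _, _, _, _, _, _, .seq _ d => d.iterations
  | _, _, _, _, _, _, _, _ => 0

/-- The values of the derivations from a configuration sum up to the values of `(C, F)`. -/
structure Adequate {Γ Δ : Finset X} {S : Stmt X} (t : Typing Γ S Δ) (ψ : Hilb Γ)
    (p : Den Γ Δ) : Prop where
  hasSum : HasSum (fun d : Outcome t ψ => ketbra d.1.1) (p.1 (ketbra ψ))
  exists_true : ∃ d : Outcome t ψ, d.1 = (p.2 *ᵥ ψ, true) ∧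
    ∀ d' : Outcome t ψ, d'.1.2 = true → d' = d

/-! ### Inversion of the transition rules -/

section Equivalences

variable {Γ Γ' Γ'' : Finset X} {S S₀ S₁ : Stmt X} {q : X}

/-- A derivation for a composition. -/
def outcomeSeq (t₀ : Typing Γ S₀ Γ') (t₁ : Typing Γ' S₁ Γ'') (ψ : Hilb Γ) :
    Outcome (.seq t₀ t₁) ψ ≃ Σ d : Outcome t₀ ψ, Outcome t₁ d.1.1 where
  toFun
    | ⟨(χ, _), .seq (φ := φ) (ν := ν) (μ := μ) d₀ d₁⟩ => ⟨⟨(φ, ν), d₀⟩, ⟨(χ, μ), d₁⟩⟩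
  invFun d := ⟨(d.2.1.1, d.1.1.2 && d.2.1.2), .seq d.1.2 d.2.2⟩
  left_inv := by rintro ⟨⟨_, _⟩, ⟨⟩⟩; rfl
  right_inv _ := rfl

/-- A derivation for a measurement. -/
def outcomeMeas (h : q ∈ Γ) (t₀ : Typing Γ S₀ Γ') (t₁ : Typing Γ S₁ Γ') (ψ : Hilb Γ) :
    Outcome (.meas h t₀ t₁) ψ ≃ Outcome t₀ (proj h 0 *ᵥ ψ) ⊕ Outcome t₁ (proj h 1 *ᵥ ψ) where
  toFun
    | ⟨(φ, ν), .meas₀ _ d⟩ => .inl ⟨(φ, ν), d⟩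
    | ⟨(φ, _), .meas₁ (ν := ν) _ d⟩ => .inr ⟨(φ, ν), d⟩
  invFun
    | .inl d => ⟨d.1, .meas₀ h d.2⟩
    | .inr d => ⟨(d.1.1, false), .meas₁ h d.2⟩
  left_inv := by rintro ⟨⟨_, _⟩, ⟨⟩⟩ <;> rfl
  right_inv := by rintro (_ | _) <;> rfl

/-- A derivation for a loop. -/
def outcomeWhile (h : q ∈ Γ) (t : Typing Γ S Γ) (ψ : Hilb Γ) :
    Outcome (.whileDo h t) ψ ≃
      Unit ⊕ Σ d : Outcome t (proj h 1 *ᵥ ψ), Outcome (.whileDo h t) d.1.1 where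
  toFun
    | ⟨(_, _), .while₀ _ _⟩ => .inl ()
    | ⟨(χ, _), .while₁ _ (.seq (φ := φ) (ν := ν) (μ := μ) d₀ d₁)⟩ =>
        .inr ⟨⟨(φ, ν), d₀⟩, ⟨(χ, μ), d₁⟩⟩
  invFun
    | .inl _ => ⟨(proj h 0 *ᵥ ψ, true), .while₀ h ψ⟩
    | .inr d => ⟨(d.2.1.1, false), .while₁ h (.seq d.1.2 d.2.2)⟩
  left_inv := by
    rintro ⟨⟨_, _⟩, d⟩
    cases d with
    | while₀ => rfl
    | while₁ _ d => cases d; rfl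
  right_inv := by rintro (_ | _) <;> rfl

/-- A derivation for a quantum case. -/
def outcomeQcase {Γ Γ₁ Δ Δ₁ : Finset X} (hΓ : Ext q Γ Γ₁) (hΔ : Ext q Δ Δ₁) (t₀ : Typing Γ S₀ Δ)
    (t₁ : Typing Γ S₁ Δ) (hq : q ∉ S₀.vars ∪ S₁.vars) (ψ : Hilb Γ₁) :
    Outcome (.qcase hΓ hΔ t₀ t₁ hq) ψ ≃ Outcome t₀ (bra hΓ 0 *ᵥ ψ) × Outcome t₁ (bra hΓ 1 *ᵥ ψ) where
  toFun
    | ⟨(_, _), .qcase (φ₀ := φ₀) (φ₁ := φ₁) (ν₀ := ν₀) (ν₁ := ν₁) _ _ _ d₀ d₁⟩ =>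
        (⟨(φ₀, ν₀), d₀⟩, ⟨(φ₁, ν₁), d₁⟩)
  invFun d := ⟨(bit d.2.1.2 • (ket hΔ 0 *ᵥ d.1.1.1) + bit d.1.1.2 • (ket hΔ 1 *ᵥ d.2.1.1),
    d.1.1.2 && d.2.1.2), .qcase hΓ hΔ hq d.1.2 d.2.2⟩
  left_inv := by rintro ⟨⟨_, _⟩, ⟨⟩⟩; rfl
  right_inv _ := rfl

/-- A derivation for the discarding of a qubit. -/
def outcomeDiscard (h : Ext q Γ' Γ) (ψ : Hilb Γ) : Outcome (.discard h) ψ ≃ Unit ⊕ Unit where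
  toFun
    | ⟨(_, _), .discard₀ _ _⟩ => .inl ()
    | ⟨(_, _), .discard₁ _ _⟩ => .inr ()
  invFun
    | .inl _ => ⟨(bra h 0 *ᵥ ψ, true), .discard₀ h ψ⟩
    | .inr _ => ⟨(bra h 1 *ᵥ ψ, false), .discard₁ h ψ⟩
  left_inv := by rintro ⟨⟨_, _⟩, ⟨⟩⟩ <;> rfl
  right_inv := by rintro (_ | _) <;> rfl

end Equivalences

/-! ### Adequacy of each construct -/

section Adequacy

variable {Γ Γ' Γ'' : Finset X} {S S₀ S₁ : Stmt X} {q : X}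

theorem Adequate.of_unique {t : Typing Γ S Γ'} {ψ : Hilb Γ} {M : Op Γ Γ'}
    (d : Exec t ψ (M *ᵥ ψ) true) (hd : ∀ d' : Outcome t ψ, d' = ⟨(M *ᵥ ψ, true), d⟩) :
    Adequate t ψ (conjBy M, M) := by
  refine ⟨?_, ⟨_, d⟩, rfl, fun d' _ => hd d'⟩
  have := hasSum_single (f := fun d : Outcome t ψ => ketbra d.1.1) ⟨(M *ᵥ ψ, true), d⟩
    fun d' h => absurd (hd d') h
  rwa [← conjBy_ketbra] at this

theorem Adequate.discard (h : Ext q Γ' Γ) (ψ : Hilb Γ) :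
    Adequate (.discard h) ψ (conjBy (bra h 0) + conjBy (bra h 1), bra h 0) := by
  refine ⟨?_, ⟨(_, true), .discard₀ h ψ⟩, rfl, ?_⟩
  · rw [← (outcomeDiscard h ψ).symm.hasSum_iff, LinearMap.add_apply, conjBy_ketbra, conjBy_ketbra]
    exact HasSum.sum (hasSum_unique _) (hasSum_unique _)
  · rintro ⟨⟨_, _⟩, ⟨⟩⟩ hν
    · rfl
    · cases hν

/-- The second statement starts from any of the vectors output by the first, whence the hypothesis
for all `φ`; linearity and continuity of the second map carry it through the first sum. -/
theorem Adequate.seq {t₀ : Typing Γ S₀ Γ'} {t₁ : Typing Γ' S₁ Γ''} {ψ : Hilb Γ} {p₀ : Den Γ Γ'}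
    {p₁ : Den Γ' Γ''} (h₀ : Adequate t₀ ψ p₀) (h₁ : ∀ φ, Adequate t₁ φ p₁) :
    Adequate (.seq t₀ t₁) ψ (p₁.comp p₀) := by
  refine ⟨?_, ?_⟩
  · rw [← (outcomeSeq t₀ t₁ ψ).symm.hasSum_iff]
    exact hasSum_ketbra_sigma (f := fun d : Σ d : Outcome t₀ ψ, Outcome t₁ d.1.1 => d.2.1.1)
      (fun d => (h₁ d.1.1).hasSum) (hasSum_superOp p₁.1 h₀.hasSum)
  · obtain ⟨⟨v₀, d₀⟩, h₀', u₀⟩ := h₀.exists_true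
    obtain rfl : v₀ = _ := h₀'
    obtain ⟨⟨v₁, d₁⟩, h₁', u₁⟩ := (h₁ (p₀.2 *ᵥ ψ)).exists_true
    obtain rfl : v₁ = _ := h₁'
    refine ⟨⟨(_, _), .seq d₀ d₁⟩, by simp [Den.comp, Matrix.mulVec_mulVec], ?_⟩
    rintro ⟨⟨_, _⟩, d⟩ hν
    cases d with
    | seq e₀ e₁ =>
      obtain ⟨rfl, rfl⟩ := (Bool.and_eq_true_iff).1 hν
      cases u₀ ⟨(_, true), e₀⟩ rfl
      cases u₁ ⟨(_, true), e₁⟩ rfl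
      rfl

theorem Adequate.meas (h : q ∈ Γ) {t₀ : Typing Γ S₀ Γ'} {t₁ : Typing Γ S₁ Γ'} {ψ : Hilb Γ}
    {p₀ p₁ : Den Γ Γ'} (h₀ : Adequate t₀ (proj h 0 *ᵥ ψ) p₀)
    (h₁ : Adequate t₁ (proj h 1 *ᵥ ψ) p₁) : Adequate (.meas h t₀ t₁) ψ (Den.meas h p₀ p₁) := by
  refine ⟨?_, ?_⟩
  · rw [← (outcomeMeas h t₀ t₁ ψ).symm.hasSum_iff]
    simp only [Den.meas, LinearMap.add_apply, LinearMap.comp_apply, conjBy_ketbra]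
    exact HasSum.sum h₀.hasSum h₁.hasSum
  · obtain ⟨⟨v₀, d₀⟩, h₀', u₀⟩ := h₀.exists_true
    obtain rfl : v₀ = _ := h₀'
    refine ⟨⟨(_, _), .meas₀ h d₀⟩, by simp [Den.meas, Matrix.mulVec_mulVec], ?_⟩
    rintro ⟨⟨_, _⟩, d⟩ hν
    cases d with
    | meas₀ _ e =>
      obtain rfl : _ = true := hν
      cases u₀ ⟨(_, true), e⟩ rfl
      rfl
    | meas₁ => cases hν

/-- Peeling off the first run of the body corresponds to `Tⁿ⁺¹ = Tⁿ T`. Derivations with another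
iteration count are kept in the family but contribute the zero vector. -/
theorem hasSum_iterations_eq (h : q ∈ Γ) {t : Typing Γ S Γ} {p : Den Γ Γ}
    (ht : ∀ ψ, Adequate t ψ p) (n : ℕ) (ψ : Hilb Γ) :
    HasSum (fun d : Outcome (.whileDo h t) ψ => ketbra (if d.2.iterations = n then d.1.1 else 0))
      (conjBy (proj h 0) (((p.1 ∘ₗ conjBy (proj h 1)) ^ n :
        Module.End ℂ (Matrix (Basis Γ) (Basis Γ) ℂ)) (ketbra ψ))) := by
  induction n generalizing ψ with
  | zero =>
    rw [← (outcomeWhile h t ψ).symm.hasSum_iff, pow_zero, Module.End.one_apply, conjBy_ketbra,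
      ← add_zero (ketbra _)]
    refine HasSum.sum ?_ ?_
    · exact hasSum_unique (fun _ : Unit => ketbra (proj h 0 *ᵥ ψ))
    · convert hasSum_zero using 1
      funext d
      simp [outcomeWhile, Exec.iterations]
  | succ n ih =>
    rw [← (outcomeWhile h t ψ).symm.hasSum_iff, pow_succ, Module.End.mul_apply,
      LinearMap.comp_apply, conjBy_ketbra, ← zero_add (conjBy _ _)]
    refine HasSum.sum ?_ ?_
    · convert hasSum_zero using 1
      funext d
      simp [outcomeWhile, Exec.iterations]
    · have := hasSum_ketbra_sigma
        (f := fun d : Σ d : Outcome t (proj h 1 *ᵥ ψ), Outcome (.whileDo h t) d.1.1 =>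
          if d.2.2.iterations = n then d.2.1.1 else 0)
        (fun d => ih d.1.1) (hasSum_superOp (conjBy (proj h 0) ∘ₗ
          ((p.1 ∘ₗ conjBy (proj h 1)) ^ n : Module.End ℂ _)) (ht (proj h 1 *ᵥ ψ)).hasSum)
      convert this using 1
      · funext d
        simp [outcomeWhile, Exec.iterations]
      · rfl

theorem Adequate.whileDo (h : q ∈ Γ) {t : Typing Γ S Γ} {p : Den Γ Γ} (ht : ∀ ψ, Adequate t ψ p)
    {C : SuperOp (Basis Γ) (Basis Γ)}
    (hC : IsIteration (conjBy (proj h 0)) (p.1 ∘ₗ conjBy (proj h 1)) C) (ψ : Hilb Γ) :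
    Adequate (.whileDo h t) ψ (C, proj h 0) := by
  refine ⟨?_, ⟨(_, true), .while₀ h ψ⟩, rfl, ?_⟩
  -- The family is indexed by pairs of a count and a derivation. Summing over derivations first
  -- gives the series for `C`; summing over counts first leaves one term per derivation.
  · have hs := hasSum_ketbra_sigma
      (f := fun x : Σ _ : ℕ, Outcome (.whileDo h t) ψ =>
        if x.2.2.iterations = x.1 then x.2.1.1 else 0)
      (fun n => hasSum_iterations_eq h ht n ψ) (hC.hasSum (ketbra ψ))
    have hs' := ((Equiv.sigmaEquivProd _ _).trans (Equiv.prodComm _ _)).symm.hasSum_iff.2 hs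
    refine hs'.prod_fiberwise fun d => ?_
    change HasSum (fun n : ℕ => ketbra (if d.2.iterations = n then d.1.1 else 0)) _
    convert hasSum_ite_eq d.2.iterations (ketbra d.1.1) using 1
    funext n
    by_cases hn : n = d.2.iterations
    · simp [hn]
    · simp [hn, Ne.symm hn]
  · rintro ⟨⟨_, _⟩, d⟩ hν
    cases d with
    | while₀ => rfl
    | while₁ => cases hν

theorem Adequate.qcase {Γ Γ₁ Δ Δ₁ : Finset X} (hΓ : Ext q Γ Γ₁) (hΔ : Ext q Δ Δ₁)
    {t₀ : Typing Γ S₀ Δ} {t₁ : Typing Γ S₁ Δ} (hq : q ∉ S₀.vars ∪ S₁.vars) {ψ : Hilb Γ₁}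
    {p₀ p₁ : Den Γ Δ} (h₀ : Adequate t₀ (bra hΓ 0 *ᵥ ψ) p₀)
    (h₁ : Adequate t₁ (bra hΓ 1 *ᵥ ψ) p₁) :
    Adequate (.qcase hΓ hΔ t₀ t₁ hq) ψ (Den.qcase hΓ hΔ p₀ p₁) := by
  obtain ⟨d₀, h₀', u₀⟩ := h₀.exists_true
  obtain ⟨d₁, h₁', u₁⟩ := h₁.exists_true
  have hν₀ (d : Outcome t₀ (bra hΓ 0 *ᵥ ψ)) (hd : d ≠ d₀) : bit d.1.2 = 0 := by
    rw [bit, if_neg fun h => hd (u₀ d h)]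
  have hν₁ (d : Outcome t₁ (bra hΓ 1 *ᵥ ψ)) (hd : d ≠ d₁) : bit d.1.2 = 0 := by
    rw [bit, if_neg fun h => hd (u₁ d h)]
  have hbit : bit true = 1 := rfl
  refine ⟨?_, ?_⟩
  · rw [← (outcomeQcase hΓ hΔ t₀ t₁ hq ψ).symm.hasSum_iff]
    have hs₀ := hasSum_superOp (conjBy (ket hΔ 0)) h₀.hasSum
    have hs₁ := hasSum_superOp (conjBy (ket hΔ 1)) h₁.hasSum
    -- The factor `ν₁` vanishes off the pairs `(d, d₁)`, so the block at `|0⟩` is a sum over the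
    -- first component alone, and symmetrically for `|1⟩`.
    have hi₀ : Function.Injective fun d => ((d, d₁) :
      Outcome t₀ (bra hΓ 0 *ᵥ ψ) × Outcome t₁ (bra hΓ 1 *ᵥ ψ)) := fun d d' h => (Prod.ext_iff.1 h).1
    have hi₁ : Function.Injective fun d => ((d₀, d) :
      Outcome t₀ (bra hΓ 0 *ᵥ ψ) × Outcome t₁ (bra hΓ 1 *ᵥ ψ)) := fun d d' h => (Prod.ext_iff.1 h).2
    have hf₀ : HasSum (fun d : Outcome t₀ (bra hΓ 0 *ᵥ ψ) × Outcome t₁ (bra hΓ 1 *ᵥ ψ) =>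
        bit d.2.1.2 • conjBy (ket hΔ 0) (ketbra d.1.1.1))
        (conjBy (ket hΔ 0) (p₀.1 (ketbra (bra hΓ 0 *ᵥ ψ)))) := by
      refine (hi₀.hasSum_iff ?_).1 ?_
      · rintro ⟨a, b⟩ hab
        rw [hν₁ b (fun h => hab ⟨a, by rw [← h]⟩), zero_smul]
      · convert hs₀ using 1
        funext d
        simp [hbit, h₁']
    have hf₁ : HasSum (fun d : Outcome t₀ (bra hΓ 0 *ᵥ ψ) × Outcome t₁ (bra hΓ 1 *ᵥ ψ) =>
        bit d.1.1.2 • conjBy (ket hΔ 1) (ketbra d.2.1.1))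
        (conjBy (ket hΔ 1) (p₁.1 (ketbra (bra hΓ 1 *ᵥ ψ)))) := by
      refine (hi₁.hasSum_iff ?_).1 ?_
      · rintro ⟨a, b⟩ hab
        rw [hν₀ a (fun h => hab ⟨b, by rw [← h]⟩), zero_smul]
      · convert hs₁ using 1
        funext d
        simp [hbit, h₀']
    let cross (d : Outcome t₀ (bra hΓ 0 *ᵥ ψ) × Outcome t₁ (bra hΓ 1 *ᵥ ψ)) :
        Matrix (Basis Δ₁) (Basis Δ₁) ℂ :=
      Matrix.vecMulVec (bit d.2.1.2 • (ket hΔ 0 *ᵥ d.1.1.1))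
          (star (bit d.1.1.2 • (ket hΔ 1 *ᵥ d.2.1.1)))
        + Matrix.vecMulVec (bit d.1.1.2 • (ket hΔ 1 *ᵥ d.2.1.1))
          (star (bit d.2.1.2 • (ket hΔ 0 *ᵥ d.1.1.1)))
    -- Interference needs `ν₀ = ν₁ = 1`, which happens at this pair only.
    have hf₂ := hasSum_single (f := cross) (d₀, d₁) (by
      rintro ⟨a, b⟩ hab
      by_cases ha : a = d₀
      · have hb : b ≠ d₁ := fun hb => hab (by rw [ha, hb])
        simp [cross, hν₁ b hb]
      · simp [cross, hν₀ a ha])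
    convert (hf₀.add hf₁).add hf₂ using 1
    · funext d
      simp only [Function.comp_apply, outcomeQcase, Equiv.coe_fn_symm_mk, ketbra_add,
        ketbra_bit_smul, conjBy_ketbra, cross]
    · simp only [Den.qcase, LinearMap.add_apply, LinearMap.comp_apply, conjBy_ketbra, cross, h₀', h₁', hbit,
        one_smul, sandwich_apply, add_assoc]
      simp only [ketbra, Matrix.mul_vecMulVec, Matrix.vecMulVec_mul, Matrix.star_mulVec,
        Matrix.mulVec_mulVec, Matrix.conjTranspose_mul, Matrix.mul_assoc]
  · obtain ⟨v₀, d₀⟩ := d₀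
    obtain ⟨v₁, d₁⟩ := d₁
    obtain rfl : v₀ = _ := h₀'
    obtain rfl : v₁ = _ := h₁'
    refine ⟨⟨(_, _), .qcase hΓ hΔ hq d₀ d₁⟩, ?_, ?_⟩
    · simp [Den.qcase, Matrix.add_mulVec, Matrix.mulVec_mulVec, Matrix.mul_assoc, hbit]
    rintro ⟨⟨_, _⟩, d⟩ hν
    cases d with
    | qcase _ _ _ e₀ e₁ =>
      obtain ⟨rfl, rfl⟩ := (Bool.and_eq_true_iff).1 hν
      cases u₀ ⟨(_, true), e₀⟩ rfl
      cases u₁ ⟨(_, true), e₁⟩ rfl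
      rfl

theorem adequate_den {Γ Δ : Finset X} {S : Stmt X} (t : Typing Γ S Δ) (ψ : Hilb Γ) :
    Adequate t ψ (den t) := by
  induction t with
  | @skip Γ =>
    have hid : den (Typing.skip : Typing Γ .skip Γ) = (conjBy 1, 1) := by
      rw [den, Den.id]
      congr 1
      ext1 ρ; simp [conjBy_apply]
    rw [hid]
    -- The final vector of `skip` is `ψ` and not literally `1 *ᵥ ψ`; quantifying over the derivation
    -- lets the rewriting act on its type.
    have hd : ∃ d : Exec (Typing.skip : Typing Γ .skip Γ) ψ ((1 : Op Γ Γ) *ᵥ ψ) true,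
        ∀ d' : Outcome Typing.skip ψ, d' = ⟨((1 : Op Γ Γ) *ᵥ ψ, true), d⟩ := by
      rw [Matrix.one_mulVec]
      exact ⟨.skip ψ, by rintro ⟨⟨_, _⟩, ⟨⟩⟩; rfl⟩
    exact Adequate.of_unique _ hd.choose_spec
  | newQbit h =>
    rw [den]
    exact Adequate.of_unique (.newQbit h ψ) (by rintro ⟨⟨_, _⟩, ⟨⟩⟩; rfl)
  | discard h => rw [den]; exact Adequate.discard h ψ
  | gate h =>
    rw [den]
    exact Adequate.of_unique (.gate h ψ) (by rintro ⟨⟨_, _⟩, ⟨⟩⟩; rfl)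
  | seq t₀ t₁ ih₀ ih₁ => rw [den]; exact (ih₀ ψ).seq ih₁
  | meas h t₀ t₁ ih₀ ih₁ => rw [den]; exact (ih₀ _).meas h (ih₁ _)
  | whileDo h t ih =>
    obtain ⟨C, hC, -, hl⟩ := exists_isIteration_loop h (isVacuumPair_den t)
    rw [den]
    change Adequate _ ψ (lfp (Den.loop h (den t)))
    rw [hl]
    exact Adequate.whileDo h ih hC ψ
  | qcase hΓ hΔ t₀ t₁ hq ih₀ ih₁ => rw [den]; exact (ih₀ _).qcase hΓ hΔ hq (ih₁ _)

end Adequacy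

/-! ### Output ensembles -/

section Ensemble

variable {Γ Δ : Finset X} {S : Stmt X} {t : Typing Γ S Δ} {ψ : Hilb Γ} {p : Den Γ Δ}

/-- A value with zero vector has `ν = 1`, hence at most one derivation. Otherwise some diagonal
entry of `|φ⟩⟨φ|` is a nonzero constant over the derivations of the value, and summability forces
them to be finitely many. -/
theorem Adequate.finite (h : Adequate t ψ p) {v : Hilb Δ × Bool} (hv : v ≠ (0, false)) :
    Finite {d : Outcome t ψ // d.1 = v} := by
  by_cases h0 : v.1 = 0
  · have hv2 : v.2 = true := by
      by_contra h2
      exact hv (Prod.ext h0 (by simpa using h2))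
    obtain ⟨d₀, -, u₀⟩ := h.exists_true
    have : Subsingleton {d : Outcome t ψ // d.1 = v} :=
      ⟨fun d d' => Subtype.ext ((u₀ d.1 (by rw [d.2, hv2])).trans
        (u₀ d'.1 (by rw [d'.2, hv2])).symm)⟩
    infer_instance
  · obtain ⟨a, ha⟩ := Function.ne_iff.1 h0
    have hs := h.hasSum.summable.comp_injective
      (Subtype.val_injective (p := fun d : Outcome t ψ => d.1 = v))
    have hs' := Pi.summable.1 (Pi.summable.1 hs a) a
    by_contra hinf
    rw [not_finite_iff_infinite] at hinf
    have hc : ∀ d : {d : Outcome t ψ // d.1 = v},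
        ((fun d : Outcome t ψ => ketbra d.1.1) ∘ Subtype.val) d a a = v.1 a * star (v.1 a) := by
      rintro ⟨d, rfl⟩; rfl
    simp only [hc] at hs'
    rw [summable_const_iff] at hs'
    simp at hs'
    exact ha hs'

theorem outputEnsemble_of_ne {v : Hilb Δ × Bool} (hv : v ≠ (0, false)) :
    outputEnsemble t ψ v = ENat.card {d : Outcome t ψ // d.1 = v} := by
  rw [outputEnsemble, if_neg hv]
  exact ENat.card_congr (Equiv.sigmaSubtype (β := fun v : Hilb Δ × Bool => Exec t ψ v.1 v.2) v).symm

/-- A family listing the output ensemble is the family of the derivations of nonzero values. -/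
theorem Adequate.exists_equiv (h : Adequate t ψ p) {ι : Type*} {out : ι → Hilb Δ × Bool}
    (hout : Enumerates out (outputEnsemble t ψ)) :
    ∃ e : ι ≃ {d : Outcome t ψ // d.1 ≠ (0, false)}, ∀ i, (e i).1.1 = out i := by
  have he (v : Hilb Δ × Bool) : Nonempty ({i // out i = v} ≃
      {d : {d : Outcome t ψ // d.1 ≠ (0, false)} // d.1.1 = v}) := by
    have hv' := hout v
    by_cases hv : v = (0, false)
    · rw [outputEnsemble, if_pos hv, ENat.card_eq_zero_iff_empty] at hv'
      have : IsEmpty {d : {d : Outcome t ψ // d.1 ≠ (0, false)} // d.1.1 = v} :=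
        ⟨fun d => d.1.2 (d.2.trans hv)⟩
      exact ⟨Equiv.equivOfIsEmpty _ _⟩
    · rw [outputEnsemble_of_ne hv] at hv'
      -- Equal cardinals in `ℕ∞` give a bijection only for finite fibres, since `⊤` does not
      -- distinguish infinite ones.
      have hfin := h.finite hv
      have hfin' : Finite {i // out i = v} := by
        rw [← not_infinite_iff_finite, ← ENat.card_eq_top, hv', ENat.card_eq_top,
          not_infinite_iff_finite]
        exact hfin
      rw [ENat.card_eq_coe_natCard, ENat.card_eq_coe_natCard, Nat.cast_inj, Finite.card_eq] at hv'
      refine hv'.map fun e => e.trans (Equiv.subtypeSubtypeEquivSubtype fun {d} hd => ?_).symm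
      rw [hd]; exact hv
  exact ⟨Equiv.ofFiberEquiv fun v => (he v).some,
    Equiv.ofFiberEquiv_map (g := fun d : {d : Outcome t ψ // d.1 ≠ (0, false)} => d.1.1) _⟩

/-- Removing the value `(0, 0)` from the ensemble discards only zero terms. -/
theorem Adequate.hasSum_ketbra (h : Adequate t ψ p) {ι : Type*} {out : ι → Hilb Δ × Bool}
    (hout : Enumerates out (outputEnsemble t ψ)) :
    HasSum (fun i => ketbra (out i).1) (p.1 (ketbra ψ)) := by
  obtain ⟨e, he⟩ := h.exists_equiv hout
  have := e.hasSum_iff.2 ((hasSum_subtype_iff_of_support_subset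
    (s := {d : Outcome t ψ | d.1 ≠ (0, false)}) fun d hd h0 => hd (by simp [h0])).2 h.hasSum)
  simpa [Function.comp_def, he] using this

theorem Adequate.hasSum_bit_smul (h : Adequate t ψ p) {ι : Type*} {out : ι → Hilb Δ × Bool}
    (hout : Enumerates out (outputEnsemble t ψ)) :
    HasSum (fun i => bit (out i).2 • (out i).1) (p.2 *ᵥ ψ) := by
  obtain ⟨e, he⟩ := h.exists_equiv hout
  obtain ⟨d₀, h₀, u₀⟩ := h.exists_true
  have hs : HasSum (fun d : Outcome t ψ => bit d.1.2 • d.1.1) (p.2 *ᵥ ψ) := by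
    have := hasSum_single (f := fun d : Outcome t ψ => bit d.1.2 • d.1.1) d₀
      fun d hd => by
        have : bit d.1.2 = 0 := by rw [bit, if_neg fun h => hd (u₀ d h)]
        simp [this]
    simpa [bit, h₀] using this
  have := e.hasSum_iff.2 ((hasSum_subtype_iff_of_support_subset
    (s := {d : Outcome t ψ | d.1 ≠ (0, false)}) fun d hd h0 => hd (by simp [h0])).2 hs)
  simpa [Function.comp_def, he] using this

end Ensemble

end QLang

theorem theorem3 {X : Type*} [DecidableEq X] {Γ Δ : Finset X} {S : QLang.Stmt X}
    (t : QLang.Typing Γ S Δ) (ψ : QLang.Hilb Γ) (hψ : ψ ∈ QLang.St Γ)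
    (C : QLang.SuperOp (QLang.Basis Γ) (QLang.Basis Δ)) (F : QLang.Op Γ Δ)
    (hden : QLang.den t = (C, F)) :
    (∀ v, QLang.outputEnsemble t ψ v ≠ ⊤) ∧
    ∀ (ι : Type*) (out : ι → QLang.Hilb Δ × Bool),
      QLang.Enumerates out (QLang.outputEnsemble t ψ) →
        HasSum (fun i => QLang.ketbra (out i).1) (C (QLang.ketbra ψ)) ∧
        HasSum (fun i => QLang.bit (out i).2 • (out i).1) (F *ᵥ ψ) := by
  have h := QLang.adequate_den t ψ
  rw [hden] at h
  refine ⟨fun v => ?_, fun ι out hout => ⟨h.hasSum_ketbra hout, h.hasSum_bit_smul hout⟩⟩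
  by_cases hv : v = (0, false)
  · simp [QLang.outputEnsemble, hv]
  · rw [QLang.outputEnsemble_of_ne hv, Ne, ENat.card_eq_top, not_infinite_iff_finite]
    exact h.finite hv
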